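/- For a real analytic function germ $h:(\mathbb{R}^d,0)\to(\mathbb{R},0)$ and $n\ge 1$, let $\mathcal{L}_n\cong\mathbb{R}^{nd}$ be the space of truncated arcs $\gamma(t)=\mathbf a_1t+\cdots+\mathbf a_nt^n$, $\mathbf a_i\in\mathbb{R}^d$, and let $$\mathcal X_{n,+}(h)=\{\gamma\in\mathcal L_n : h(\gamma(t))=ct^n+\cdots,\ c>0\},\qquad \mathcal X_{n,-}(h)=\{\gamma\in\mathcal L_n : h(\gamma(t))=ct^n+\cdots,\ c<0\}.$$ The positive and negative zeta functions of $h$ are $$Z_{h,\pm}(T)=\sum_{n\ge1}(-1)^{-nd}\,\chi^c(\mathcal X_{n,\pm}(h))\,T^n\in\mathbb{Z}[[T]],$$ where $\chi^c$ is the Euler characteristic with compact supports (the alternating sum of the ranks of the cohomology groups with compact supports with coefficients in $\mathbb{Z}$); the total zeta function is $Z_h=Z_{h,+}+Z_{h,-}$. For functions $f,g$ put $(f*g)(x,y)=f(x)+g(y)$. **Proposition.** Let $m>1$ be odd, let $k,k'\ge 1$ be integers and $\varepsilon,\varepsilon'\in\{1,-1\}$. Put $f(x)=x^m$, $g(y)=\varepsilon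 y^k$ and $g'(y)=\varepsilon' y^{k'}$ $(x,y\in\mathbb{R})$. Suppose that $Z_{f*g,+}=Z_{f*g',+}$ and $Z_{f*g,-}=Z_{f*g',-}$. Then $k=k'$; that is, the exponent $k$ is determined by the zeta functions of $f*g$. If, moreover, $k$ is even and not divisible by $m$, then $\varepsilon=\varepsilon'$; that is, the sign of $y^k$ is determined as well. -/

import Mathlib

open Topology Asymptotics CategoryTheory

namespace AlexanderSpanier

variable {X : Type} [TopologicalSpace X]

/-- The `p`-cochains of a space `X`: arbitrary integer-valued functions of `p + 1` points of `X`. -/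
abbrev Cochain (X : Type) (p : ℕ) : Type := (Fin (p + 1) → X) → ℤ

/-- The coboundary
`(δφ)(x₀, …, x_{p+1}) = ∑ i, (-1) ^ i φ(x₀, …, x_{i-1}, x_{i+1}, …, x_{p+1})`. -/
def coboundary (X : Type) (p : ℕ) : Cochain X p →ₗ[ℤ] Cochain X (p + 1) where
  toFun φ := fun x => ∑ i : Fin (p + 2), (-1) ^ (i : ℕ) * φ (x ∘ i.succAbove)
  map_add' φ ψ := by
    ext x
    simp [mul_add, Finset.sum_add_distrib]
  map_smul' c φ := by
    ext x
    simp [Finset.mul_sum, mul_left_comm]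

theorem coboundary_coboundary (X : Type) (p : ℕ) (φ : Cochain X p) :
    coboundary X (p + 1) (coboundary X p φ) = 0 := by
  ext x
  simp only [coboundary, LinearMap.coe_mk, AddHom.coe_mk, Finset.mul_sum, Pi.zero_apply]
  rw [← Fintype.sum_prod_type' (fun (i : Fin (p + 3)) (j : Fin (p + 2)) =>
    (-1 : ℤ) ^ (i : ℕ) * ((-1) ^ (j : ℕ) * φ ((x ∘ i.succAbove) ∘ j.succAbove)))]
  refine Finset.sum_involution (fun q _ => (q.1.succAbove q.2, q.2.predAbove q.1)) ?_ ?_ ?_ ?_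
  · rintro ⟨i, j⟩ -
    have h1 : ((x ∘ (i.succAbove j).succAbove) ∘ (j.predAbove i).succAbove)
        = (x ∘ i.succAbove) ∘ j.succAbove := by
      funext k
      simp only [Function.comp_apply]
      rw [Fin.succAbove_succAbove_succAbove_predAbove]
    have h2 := Fin.neg_one_pow_succAbove_add_predAbove (R := ℤ) i j
    simp only [h1, ← mul_assoc, ← pow_add, h2]
    ring
  · rintro ⟨i, j⟩ - - h
    exact Fin.succAbove_ne i j (congrArg Prod.fst h)
  · intro _ _
    exact Finset.mem_univ _
  · rintro ⟨i, j⟩ -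
    simp [Fin.succAbove_succAbove_predAbove, Fin.predAbove_predAbove_succAbove]

/-- The support of a cochain: the points having no neighbourhood `U` such that the cochain
vanishes on all tuples of points of `U`. -/
def support {p : ℕ} (φ : Cochain X p) : Set X :=
  {x | ∀ U ∈ 𝓝 x, ∃ y : Fin (p + 1) → X, (∀ i, y i ∈ U) ∧ φ y ≠ 0}

theorem notMem_support {p : ℕ} {φ : Cochain X p} {x : X} :
    x ∉ support φ ↔ ∃ U ∈ 𝓝 x, ∀ y : Fin (p + 1) → X, (∀ i, y i ∈ U) → φ y = 0 := by
  simp [support]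

theorem isClosed_support {p : ℕ} (φ : Cochain X p) : IsClosed (support φ) := by
  rw [← isOpen_compl_iff, isOpen_iff_mem_nhds]
  intro x hx
  obtain ⟨U, hU, h⟩ := notMem_support.1 hx
  filter_upwards [eventually_mem_nhds_iff.2 hU] with z hz
  exact notMem_support.2 ⟨U, hz, h⟩

theorem support_zero {p : ℕ} : support (0 : Cochain X p) = ∅ := by
  simp [support, Set.eq_empty_iff_forall_notMem]
  exact fun _ => ⟨Set.univ, Filter.univ_mem⟩

theorem support_add {p : ℕ} (φ ψ : Cochain X p) :
    support (φ + ψ) ⊆ support φ ∪ support ψ := by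
  intro x hx
  by_contra h
  rw [Set.mem_union, not_or] at h
  obtain ⟨U, hU, h1⟩ := notMem_support.1 h.1
  obtain ⟨V, hV, h2⟩ := notMem_support.1 h.2
  refine notMem_support.2 ⟨U ∩ V, Filter.inter_mem hU hV, fun y hy => ?_⟩ hx
  simp [h1 y fun i => (hy i).1, h2 y fun i => (hy i).2]

theorem support_smul {p : ℕ} (c : ℤ) (φ : Cochain X p) : support (c • φ) ⊆ support φ := by
  intro x hx
  by_contra h
  obtain ⟨U, hU, h1⟩ := notMem_support.1 h
  refine notMem_support.2 ⟨U, hU, fun y hy => ?_⟩ hx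
  simp [h1 y hy]

theorem support_coboundary {p : ℕ} (φ : Cochain X p) :
    support (coboundary X p φ) ⊆ support φ := by
  intro x hx
  by_contra h
  obtain ⟨U, hU, h1⟩ := notMem_support.1 h
  refine notMem_support.2 ⟨U, hU, fun y hy => ?_⟩ hx
  change ∑ i : Fin (p + 2), (-1) ^ (i : ℕ) * φ (y ∘ i.succAbove) = 0
  exact Finset.sum_eq_zero fun i _ => by rw [h1 (y ∘ i.succAbove) fun j => hy _, mul_zero]

/-- The cochains with compact support. -/
def compactlySupported (X : Type) [TopologicalSpace X] (p : ℕ) : Submodule ℤ (Cochain X p) where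
  carrier := {φ | IsCompact (support φ)}
  zero_mem' := by
    simp [support_zero]
  add_mem' {φ ψ} hφ hψ :=
    (IsCompact.union hφ hψ).of_isClosed_subset (isClosed_support _) (support_add φ ψ)
  smul_mem' c φ hφ := IsCompact.of_isClosed_subset hφ (isClosed_support _) (support_smul c φ)

/-- The locally zero cochains (those with empty support), inside the compactly supported ones. -/
def locallyZero (X : Type) [TopologicalSpace X] (p : ℕ) :
    Submodule ℤ (compactlySupported X p) where
  carrier := {φ | support (φ : Cochain X p) = ∅}
  zero_mem' := support_zero
  add_mem' {φ ψ} hφ hψ := by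
    have h := support_add (φ : Cochain X p) (ψ : Cochain X p)
    rw [Set.mem_ofPred_eq] at hφ hψ ⊢
    rw [hφ, hψ, Set.union_self] at h
    exact Set.subset_empty_iff.1 h
  smul_mem' c φ hφ := by
    have h := support_smul c (φ : Cochain X p)
    rw [Set.mem_ofPred_eq] at hφ ⊢
    rw [hφ] at h
    exact Set.subset_empty_iff.1 h

/-- The coboundary on compactly supported cochains. -/
def coboundaryCompact (X : Type) [TopologicalSpace X] (p : ℕ) :
    compactlySupported X p →ₗ[ℤ] compactlySupported X (p + 1) :=
  (coboundary X p).restrict fun φ hφ =>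
    IsCompact.of_isClosed_subset hφ (isClosed_support _) (support_coboundary φ)

/-- The coboundary on compactly supported cochains modulo locally zero ones. -/
def differential (X : Type) [TopologicalSpace X] (p : ℕ) :
    (compactlySupported X p ⧸ locallyZero X p) →ₗ[ℤ]
      (compactlySupported X (p + 1) ⧸ locallyZero X (p + 1)) :=
  Submodule.mapQ _ _ (coboundaryCompact X p) fun φ hφ =>
    Set.subset_empty_iff.1 ((support_coboundary (φ : Cochain X p)).trans (le_of_eq hφ))

theorem differential_comp (X : Type) [TopologicalSpace X] (p : ℕ) :
    differential X (p + 1) ∘ₗ differential X p = 0 := by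
  refine LinearMap.ext fun q => ?_
  obtain ⟨φ, rfl⟩ := Submodule.Quotient.mk_surjective _ q
  have h : coboundaryCompact X (p + 1) (coboundaryCompact X p φ) = 0 :=
    Subtype.ext (coboundary_coboundary X p φ)
  change Submodule.Quotient.mk (coboundaryCompact X (p + 1) (coboundaryCompact X p φ)) = 0
  rw [h, Submodule.Quotient.mk_zero]

/-- The Alexander–Spanier complex with compact supports: compactly supported cochains modulo
locally zero cochains. On a locally compact Hausdorff space its cohomology is the sheaf cohomology
with compact supports with coefficients in the constant sheaf `ℤ`. -/
noncomputable def complex (X : Type) [TopologicalSpace X] : CochainComplex (ModuleCat ℤ) ℕ :=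
  CochainComplex.of (fun p => ModuleCat.of ℤ (compactlySupported X p ⧸ locallyZero X p))
    (fun p => ModuleCat.ofHom (differential X p))
    (fun p => by rw [← ModuleCat.ofHom_comp, differential_comp]; rfl)

end AlexanderSpanier

/-- The Euler characteristic with compact supports: the alternating sum of the ranks of the
cohomology groups with compact supports and integer coefficients. -/
noncomputable def eulerCharCompact (X : Type) [TopologicalSpace X] : ℤ :=
  (AlexanderSpanier.complex X).homologyEulerChar

section Zeta

variable {ι κ : Type} [Fintype ι] [Fintype κ]

/-- The arc `γ(t) = a₁ t + ⋯ + aₙ tⁿ` with coefficient vectors `aⱼ`; the coefficient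
`a_{j+1}` is `a j`. Truncated arcs are identified with their tuples of coefficients. -/
def truncatedArc {n : ℕ} (a : Fin n → ι → ℝ) (t : ℝ) : ι → ℝ :=
  ∑ j : Fin n, t ^ ((j : ℕ) + 1) • a j

/-- `f(γ(t)) = c tⁿ + (terms of order > n)` for the truncated arc `γ` with coefficients `a`. -/
def HasTerm (f : (ι → ℝ) → ℝ) {n : ℕ} (a : Fin n → ι → ℝ) (c : ℝ) : Prop :=
  (fun t : ℝ => f (truncatedArc a t) - c * t ^ n) =O[𝓝 0] fun t : ℝ => t ^ (n + 1)

/-- The truncated arcs `γ` of degree `≤ n` with `f(γ(t)) = c tⁿ + ⋯`, `c > 0`. -/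
def arcsPos (f : (ι → ℝ) → ℝ) (n : ℕ) : Set (Fin n → ι → ℝ) :=
  {a | ∃ c : ℝ, 0 < c ∧ HasTerm f a c}

/-- The truncated arcs `γ` of degree `≤ n` with `f(γ(t)) = c tⁿ + ⋯`, `c < 0`. -/
def arcsNeg (f : (ι → ℝ) → ℝ) (n : ℕ) : Set (Fin n → ι → ℝ) :=
  {a | ∃ c : ℝ, c < 0 ∧ HasTerm f a c}

/-- The positive zeta function of `f : (ℝ^ι, 0) → (ℝ, 0)`. (Note `(-1)^(-nd) = (-1)^(nd)`.) -/
noncomputable def zetaPos (f : (ι → ℝ) → ℝ) : PowerSeries ℤ :=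
  PowerSeries.mk fun n =>
    if n = 0 then 0 else (-1) ^ (n * Fintype.card ι) * eulerCharCompact (arcsPos f n)

/-- The negative zeta function of `f`. -/
noncomputable def zetaNeg (f : (ι → ℝ) → ℝ) : PowerSeries ℤ :=
  PowerSeries.mk fun n =>
    if n = 0 then 0 else (-1) ^ (n * Fintype.card ι) * eulerCharCompact (arcsNeg f n)

/-- The germ `(f * g)(x, y) = f(x) + g(y)` in separate variables. -/
def starSum (f : (ι → ℝ) → ℝ) (g : (κ → ℝ) → ℝ) (z : ι ⊕ κ → ℝ) : ℝ :=
  f (fun i => z (Sum.inl i)) + g (fun j => z (Sum.inr j))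

end Zeta

/-- The germ `x ↦ ε xᵏ` in one variable, with a sign `ε = ±1`. -/
def signedPower (ε : ℤˣ) (k : ℕ) (x : Fin 1 → ℝ) : ℝ := ((ε : ℤ) : ℝ) * x 0 ^ k

/-! The exponent is read off from the first coefficients of the zeta functions at which the term εyᵏ
is felt. Let n be the order of xᵐ + εyᵏ along an arc. If n < k, then yᵏ has too high an order to
matter, so n must be a multiple of m; hence for n < k with m ∤ n both arc sets are empty
(`signedArcs_eq_empty`). If m ∤ k, the arcs of order k have leading coefficient ε y₁ᵏ, where y₁ is
the first coefficient of y, and each arc set is a union of open half lines times a Euclidean space;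
the two signs together account for two half lines. If k = mq, the arcs of order k + 1 are those
whose terms of order k cancel. Since m is odd, this fixes the coefficient of x at t^q uniquely, and
the next coefficient is linear in a new variable, so for each sign the arc set is (ℝ ∖ 0) times a
Euclidean space: four half lines in total.

Now let k < k'. At order k (if m ∤ k) the absolute values of χᶜ, summed over both signs, are 2
against 0; at order k + 1 (if m ∣ k) they are 4 against 0 or 2, the latter when k' = k + 1. This is
`not_lt_of_zeta_eq`. For k even and m ∤ k, the two half lines both belong to the sign ε, so the
coefficient at k detects ε.

The topological input is the value (-1)^N |F| of χᶜ on F × ℝ^N for F finite and discrete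
(`eulerCharCompact_prod_euclidean`). It follows by induction from the suspension isomorphism between
the compactly supported cohomology of X in degree p and that of X × ℝ in degree p + 1, proved on
Alexander–Spanier cochains by prism operators. -/

namespace AlexanderSpanier

/-! ### Compactly supported cohomology as a quotient of cochains, and its homeomorphism invariance
-/

section Cohomology

variable {X Y : Type} [TopologicalSpace X] [TopologicalSpace Y]

theorem coboundary_apply {X : Type} {p : ℕ} (φ : Cochain X p) (x : Fin (p + 2) → X) :
    coboundary X p φ x = ∑ i : Fin (p + 2), (-1) ^ (i : ℕ) * φ (x ∘ i.succAbove) := rfl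

theorem support_eq_empty_iff {p : ℕ} {φ : Cochain X p} :
    support φ = ∅ ↔ ∀ x, ∃ U ∈ 𝓝 x, ∀ y : Fin (p + 1) → X, (∀ i, y i ∈ U) → φ y = 0 := by
  rw [Set.eq_empty_iff_forall_notMem]
  exact forall_congr' fun x => notMem_support

/-- The cochains with empty support, as a submodule of all cochains. -/
def nullCochains (X : Type) [TopologicalSpace X] (p : ℕ) : Submodule ℤ (Cochain X p) where
  carrier := {φ | support φ = ∅}
  zero_mem' := support_zero
  add_mem' {φ ψ} hφ hψ := by
    have h := support_add φ ψ
    rw [Set.mem_ofPred_eq] at hφ hψ ⊢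
    rw [hφ, hψ, Set.union_self] at h
    exact Set.subset_empty_iff.1 h
  smul_mem' c φ hφ := by
    have h := support_smul c φ
    rw [Set.mem_ofPred_eq] at hφ ⊢
    rw [hφ] at h
    exact Set.subset_empty_iff.1 h

theorem mem_nullCochains {p : ℕ} {φ : Cochain X p} :
    φ ∈ nullCochains X p ↔ support φ = ∅ := Iff.rfl

theorem mem_nullCochains_iff {p : ℕ} {φ : Cochain X p} :
    φ ∈ nullCochains X p ↔
      ∀ x, ∃ U ∈ 𝓝 x, ∀ y : Fin (p + 1) → X, (∀ i, y i ∈ U) → φ y = 0 :=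
  support_eq_empty_iff

theorem mem_compactlySupported {p : ℕ} {φ : Cochain X p} :
    φ ∈ compactlySupported X p ↔ IsCompact (support φ) := Iff.rfl

theorem coboundary_mem_nullCochains {p : ℕ} {φ : Cochain X p} (h : φ ∈ nullCochains X p) :
    coboundary X p φ ∈ nullCochains X (p + 1) :=
  Set.subset_empty_iff.1 ((support_coboundary φ).trans (le_of_eq h))

/-- The compactly supported cochains whose coboundary is locally zero. -/
def cocycles (X : Type) [TopologicalSpace X] (p : ℕ) : Submodule ℤ (Cochain X p) :=
  compactlySupported X p ⊓ (nullCochains X (p + 1)).comap (coboundary X p)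

theorem mem_cocycles {p : ℕ} {φ : Cochain X p} :
    φ ∈ cocycles X p ↔
      φ ∈ compactlySupported X p ∧ coboundary X p φ ∈ nullCochains X (p + 1) := Iff.rfl

/-- The coboundaries of compactly supported cochains, up to locally zero cochains. -/
def coboundaries (X : Type) [TopologicalSpace X] : (p : ℕ) → Submodule ℤ (Cochain X p)
  | 0 => nullCochains X 0
  | p + 1 => nullCochains X (p + 1) ⊔ (compactlySupported X p).map (coboundary X p)

theorem mem_coboundaries_zero {φ : Cochain X 0} :
    φ ∈ coboundaries X 0 ↔ φ ∈ nullCochains X 0 := Iff.rfl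

theorem mem_coboundaries_succ {p : ℕ} {φ : Cochain X (p + 1)} :
    φ ∈ coboundaries X (p + 1) ↔
      ∃ η ∈ compactlySupported X p, φ - coboundary X p η ∈ nullCochains X (p + 1) := by
  simp only [coboundaries, Submodule.mem_sup, Submodule.mem_map]
  constructor
  · rintro ⟨y, hy, _, ⟨η, hη, rfl⟩, rfl⟩
    exact ⟨η, hη, by simpa using hy⟩
  · rintro ⟨η, hη, h⟩
    exact ⟨_, h, _, ⟨η, hη, rfl⟩, by simp⟩

theorem nullCochains_le_coboundaries (p : ℕ) : nullCochains X p ≤ coboundaries X p := by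
  cases p with
  | zero => exact le_rfl
  | succ p => exact le_sup_left

/-- Cohomology with compact supports, as cocycles modulo coboundaries. -/
abbrev Cohomology (X : Type) [TopologicalSpace X] (p : ℕ) : Type :=
  cocycles X p ⧸ (coboundaries X p).submoduleOf (cocycles X p)

/-- A map of cochain modules that preserves cocycles, reflects and preserves coboundaries, and is
surjective on cocycles up to coboundaries induces an isomorphism in cohomology. -/
theorem finrank_cohomology_congr {p q : ℕ} (T : Cochain X p →ₗ[ℤ] Cochain Y q)
    (hT : ∀ φ ∈ cocycles X p, T φ ∈ cocycles Y q)
    (hB : ∀ φ ∈ cocycles X p, T φ ∈ coboundaries Y q ↔ φ ∈ coboundaries X p)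
    (hsurj : ∀ ω ∈ cocycles Y q, ∃ φ ∈ cocycles X p, T φ - ω ∈ coboundaries Y q) :
    Module.finrank ℤ (Cohomology X p) = Module.finrank ℤ (Cohomology Y q) := by
  let F : cocycles X p →ₗ[ℤ] Cohomology Y q :=
    (Submodule.mkQ _) ∘ₗ (T.restrict hT)
  have hF : Function.Surjective F := by
    intro z
    obtain ⟨⟨ω, hω⟩, rfl⟩ := Submodule.Quotient.mk_surjective _ z
    obtain ⟨φ, hφ, h⟩ := hsurj ω hω
    exact ⟨⟨φ, hφ⟩, (Submodule.Quotient.eq _).2 h⟩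
  have hk : LinearMap.ker F = (coboundaries X p).submoduleOf (cocycles X p) := by
    ext ⟨φ, hφ⟩
    rw [LinearMap.mem_ker]
    exact (Submodule.Quotient.mk_eq_zero _).trans (hB φ hφ)
  exact ((Submodule.quotEquivOfEq _ _ hk).symm.trans
    (F.quotKerEquivOfSurjective hF)).finrank_eq

/-- The map from `M` to `ker g / im f` induced by `π` is onto by `h2` and has kernel `N` by `h3`.
This trades the homology of a complex of quotients for a quotient of submodules of honest cochains.
-/
theorem finrank_shortComplex_homology {R : Type} [Ring R] {S : ShortComplex (ModuleCat.{0} R)}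
    {M : Type} [AddCommGroup M] [Module R M] (N : Submodule R M) (π : M →ₗ[R] S.X₂) (h1 : ∀ x, S.g (π x) = 0)
    (h2 : ∀ z, S.g z = 0 → ∃ x, π x = z) (h3 : ∀ x, (∃ w, S.f w = π x) ↔ x ∈ N) :
    Module.finrank R S.homology = Module.finrank R (M ⧸ N) := by
  rw [S.moduleCatHomologyIso.toLinearEquiv.finrank_eq]
  let F : M →ₗ[R] (LinearMap.ker S.g.hom ⧸ LinearMap.range S.moduleCatToCycles) :=
    (Submodule.mkQ _) ∘ₗ (π.codRestrict (LinearMap.ker S.g.hom) h1)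
  have hF : Function.Surjective F := by
    intro z
    obtain ⟨⟨ω, hω⟩, rfl⟩ := Submodule.Quotient.mk_surjective _ z
    obtain ⟨φ, h⟩ := h2 ω hω
    exact ⟨φ, congrArg _ (Subtype.ext h)⟩
  have hk : LinearMap.ker F = N := by
    ext φ
    rw [LinearMap.mem_ker]
    refine (Submodule.Quotient.mk_eq_zero _).trans (Iff.trans ?_ (h3 φ))
    rw [LinearMap.mem_range]
    exact exists_congr fun w => Subtype.ext_iff
  exact ((Submodule.quotEquivOfEq _ _ hk).symm.trans
    (F.quotKerEquivOfSurjective hF)).finrank_eq.symm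

theorem mk_eq_zero_iff {p : ℕ} (φ : compactlySupported X p) :
    (Submodule.Quotient.mk φ : compactlySupported X p ⧸ locallyZero X p) = 0 ↔
      (φ : Cochain X p) ∈ nullCochains X p :=
  Submodule.Quotient.mk_eq_zero _

theorem finrank_homology_complex (X : Type) [TopologicalSpace X] (p : ℕ) :
    Module.finrank ℤ ((complex X).homology p) = Module.finrank ℤ (Cohomology X p) := by
  have hn : (ComplexShape.up ℕ).next p = p + 1 := CochainComplex.next ℕ p
  have hg : (complex X).d p (p + 1) = ModuleCat.ofHom (differential X p) := by
    simp [complex]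
  let π : cocycles X p →ₗ[ℤ] (compactlySupported X p ⧸ locallyZero X p) :=
    (Submodule.mkQ _) ∘ₗ Submodule.inclusion inf_le_left
  have hπ : ∀ (φ : Cochain X p) (h : φ ∈ cocycles X p),
      differential X p (π ⟨φ, h⟩) = 0 := fun φ h => (mk_eq_zero_iff _).2 h.2
  have hπ' : ∀ z, differential X p z = 0 → ∃ x, π x = z := by
    intro z hz
    obtain ⟨⟨φ, hφ⟩, rfl⟩ := Submodule.Quotient.mk_surjective _ z
    exact ⟨⟨φ, hφ, (mk_eq_zero_iff (coboundaryCompact X p ⟨φ, hφ⟩)).1 hz⟩, rfl⟩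
  cases p with
  | zero =>
    -- In degree 0 the predecessor index is 0 itself, so the incoming differential is the zero map
    -- `d 0 0`.
    have hf : (complex X).d 0 0 = 0 := (complex X).shape _ _ (by simp)
    rw [((complex X).homologyIsoSc' 0 0 1 (by simp) hn).toLinearEquiv.finrank_eq]
    refine finrank_shortComplex_homology _ π ?_ ?_ ?_
    · rintro ⟨φ, h⟩
      change (complex X).d 0 1 _ = 0
      rw [hg]
      exact hπ φ h
    · intro z hz
      change (complex X).d 0 1 _ = 0 at hz
      rw [hg] at hz
      exact hπ' z hz
    · rintro ⟨φ, h⟩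
      change (∃ w, (complex X).d 0 0 w = π ⟨φ, h⟩) ↔ φ ∈ coboundaries X 0
      rw [hf, mem_coboundaries_zero]
      constructor
      · rintro ⟨w, hw⟩
        exact (mk_eq_zero_iff _).1 hw.symm
      · intro hw
        exact ⟨0, ((mk_eq_zero_iff ⟨φ, h.1⟩).2 hw).symm⟩
  | succ p =>
    have hf : (complex X).d p (p + 1) = ModuleCat.ofHom (differential X p) := by
      simp [complex]
    rw [((complex X).homologyIsoSc' p (p + 1) (p + 1 + 1) (by simp) hn).toLinearEquiv.finrank_eq]
    refine finrank_shortComplex_homology _ π ?_ ?_ ?_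
    · rintro ⟨φ, h⟩
      change (complex X).d (p + 1) (p + 1 + 1) _ = 0
      rw [hg]
      exact hπ φ h
    · intro z hz
      change (complex X).d (p + 1) (p + 1 + 1) _ = 0 at hz
      rw [hg] at hz
      exact hπ' z hz
    · rintro ⟨φ, h⟩
      change (∃ w, (complex X).d p (p + 1) w = π ⟨φ, h⟩) ↔ φ ∈ coboundaries X (p + 1)
      rw [hf, mem_coboundaries_succ]
      constructor
      · rintro ⟨w, hw⟩
        obtain ⟨⟨η, hη⟩, rfl⟩ := Submodule.Quotient.mk_surjective _ w
        refine ⟨η, hη, ?_⟩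
        exact (Submodule.Quotient.eq (locallyZero X (p + 1))
          (x := (⟨φ, h.1⟩ : compactlySupported X (p + 1)))
          (y := coboundaryCompact X p ⟨η, hη⟩)).1 hw.symm
      · rintro ⟨η, hη, hw⟩
        refine ⟨Submodule.Quotient.mk ⟨η, hη⟩, Eq.symm ?_⟩
        exact (Submodule.Quotient.eq (locallyZero X (p + 1))
          (x := (⟨φ, h.1⟩ : compactlySupported X (p + 1)))
          (y := coboundaryCompact X p ⟨η, hη⟩)).2 hw

/-- The pullback of cochains along a map. -/
def pullback (f : X → Y) (p : ℕ) : Cochain Y p →ₗ[ℤ] Cochain X p where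
  toFun φ := fun x => φ (f ∘ x)
  map_add' _ _ := rfl
  map_smul' _ _ := rfl

theorem pullback_apply {X Y : Type} (f : X → Y) {p : ℕ} (φ : Cochain Y p) (x : Fin (p + 1) → X) :
    pullback f p φ x = φ (f ∘ x) := rfl

theorem support_pullback {f : X → Y} (hf : Continuous f) {p : ℕ} (φ : Cochain Y p) :
    support (pullback f p φ) ⊆ f ⁻¹' support φ := by
  intro x hx
  by_contra h
  obtain ⟨U, hU, h1⟩ := notMem_support.1 h
  exact notMem_support.2 ⟨f ⁻¹' U, hf.continuousAt hU, fun y hy => h1 _ hy⟩ hx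

theorem pullback_mem_nullCochains {f : X → Y} (hf : Continuous f) {p : ℕ} {φ : Cochain Y p}
    (h : φ ∈ nullCochains Y p) : pullback f p φ ∈ nullCochains X p := by
  have := support_pullback hf φ
  rw [mem_nullCochains.1 h, Set.preimage_empty] at this
  exact Set.subset_empty_iff.1 this

theorem pullback_mem_compactlySupported (e : X ≃ₜ Y) {p : ℕ} {φ : Cochain Y p}
    (h : φ ∈ compactlySupported Y p) : pullback e p φ ∈ compactlySupported X p :=
  IsCompact.of_isClosed_subset (e.isCompact_preimage.2 h) (isClosed_support _)
    (support_pullback e.continuous φ)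

theorem pullback_mem_cocycles (e : X ≃ₜ Y) {p : ℕ} {φ : Cochain Y p}
    (h : φ ∈ cocycles Y p) : pullback e p φ ∈ cocycles X p :=
  ⟨pullback_mem_compactlySupported e h.1, pullback_mem_nullCochains e.continuous h.2⟩

theorem pullback_mem_coboundaries (e : X ≃ₜ Y) {p : ℕ} {φ : Cochain Y p}
    (h : φ ∈ coboundaries Y p) : pullback e p φ ∈ coboundaries X p := by
  cases p with
  | zero => exact pullback_mem_nullCochains e.continuous h
  | succ p =>
    obtain ⟨η, hη, h⟩ := mem_coboundaries_succ.1 h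
    exact mem_coboundaries_succ.2 ⟨pullback e p η, pullback_mem_compactlySupported e hη,
      pullback_mem_nullCochains e.continuous h⟩

theorem pullback_symm_pullback (e : X ≃ₜ Y) {p : ℕ} (φ : Cochain X p) :
    pullback e p (pullback e.symm p φ) = φ := by
  ext x
  simp only [pullback_apply]
  congr 1
  ext i
  simp

theorem finrank_cohomology_homeomorph (e : X ≃ₜ Y) (p : ℕ) :
    Module.finrank ℤ (Cohomology Y p) = Module.finrank ℤ (Cohomology X p) := by
  refine finrank_cohomology_congr (pullback e p) (fun φ => pullback_mem_cocycles e)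
    (fun φ _ => ⟨fun h => ?_, pullback_mem_coboundaries e⟩) fun ω hω => ?_
  · have := pullback_mem_coboundaries e.symm h
    have h' := pullback_symm_pullback e.symm φ
    rw [e.symm_symm] at h'
    rwa [h'] at this
  · refine ⟨pullback e.symm p ω, pullback_mem_cocycles e.symm hω, ?_⟩
    rw [pullback_symm_pullback, sub_self]
    exact Submodule.zero_mem _

theorem eulerCharCompact_homeomorph (e : X ≃ₜ Y) :
    eulerCharCompact X = eulerCharCompact Y := by
  simp only [eulerCharCompact, HomologicalComplex.homologyEulerChar, GradedObject.eulerChar,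
    finrank_homology_complex, finrank_cohomology_homeomorph e]

end Cohomology

/-! ### Finite discrete spaces -/

section Discrete

variable {F : Type} [TopologicalSpace F] [DiscreteTopology F]

theorem mem_nullCochains_discrete {p : ℕ} {φ : Cochain F p} :
    φ ∈ nullCochains F p ↔ ∀ s, φ (fun _ => s) = 0 := by
  rw [mem_nullCochains_iff]
  constructor
  · intro h s
    obtain ⟨U, hU, h⟩ := h s
    exact h _ fun _ => mem_of_mem_nhds hU
  · intro h s
    refine ⟨{s}, by simp, fun y hy => ?_⟩
    rw [show y = fun _ => s from funext hy]
    exact h s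

/-- An alternating sum of p + 2 equal terms. On a discrete space only the values on constant tuples
survive modulo locally zero cochains, so the complex has differentials 0, 1, 0, 1, …. -/
theorem coboundary_const {F : Type} {p : ℕ} (φ : Cochain F p) (s : F) :
    coboundary F p φ (fun _ => s) = if Even p then 0 else φ (fun _ => s) := by
  rw [coboundary_apply]
  have : ∀ i : Fin (p + 2), φ ((fun _ => s) ∘ i.succAbove) = φ (fun _ => s) := fun i => rfl
  simp only [this, ← Finset.sum_mul]
  rw [Fin.sum_univ_eq_sum_range (fun i => (-1 : ℤ) ^ i), neg_one_geom_sum]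
  by_cases h : Even p <;> simp [h, Nat.even_add]

theorem mem_compactlySupported_finite {F : Type} [TopologicalSpace F] [Finite F] {p : ℕ} (φ : Cochain F p) :
    φ ∈ compactlySupported F p := (Set.toFinite _).isCompact

theorem finrank_cohomology_discrete_zero [Finite F] :
    Module.finrank ℤ (Cohomology F 0) = Nat.card F := by
  have := Fintype.ofFinite F
  let T : (F → ℤ) →ₗ[ℤ] cocycles F 0 :=
    { toFun := fun u => ⟨fun x => u (x 0), mem_compactlySupported_finite _,
        mem_nullCochains_discrete.2 fun s => by rw [coboundary_const]; simp⟩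
      map_add' := fun _ _ => rfl
      map_smul' := fun _ _ => rfl }
  let G : (F → ℤ) →ₗ[ℤ] Cohomology F 0 := (Submodule.mkQ _) ∘ₗ T
  have hG : Function.Bijective G := by
    constructor
    · rw [injective_iff_map_eq_zero]
      intro u hu
      have := mem_nullCochains_discrete.1 
        ((Submodule.Quotient.mk_eq_zero
          ((coboundaries F 0).submoduleOf (cocycles F 0)) (x := T u)).1 hu)
      exact funext this
    · intro z
      obtain ⟨⟨ω, hω⟩, rfl⟩ := Submodule.Quotient.mk_surjective _ z
      refine ⟨fun s => ω fun _ => s, congrArg _ (Subtype.ext (funext fun x => ?_))⟩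
      exact congrArg ω (funext fun i => congrArg x (Subsingleton.elim (α := Fin 1) _ _))
  rw [← (LinearEquiv.ofBijective G hG).finrank_eq, Module.finrank_pi, Nat.card_eq_fintype_card]

theorem finrank_cohomology_eq_zero {X : Type} [TopologicalSpace X] {p : ℕ}
    (h : ∀ φ ∈ cocycles X p, φ ∈ coboundaries X p) : Module.finrank ℤ (Cohomology X p) = 0 := by
  have : Subsingleton (Cohomology X p) := by
    rw [Submodule.Quotient.subsingleton_iff, Submodule.submoduleOf_eq_top]
    exact h
  exact Module.finrank_zero_of_subsingleton

theorem finrank_cohomology_discrete_succ [Finite F] (p : ℕ) :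
    Module.finrank ℤ (Cohomology F (p + 1)) = 0 := by
  refine finrank_cohomology_eq_zero fun φ hφ => ?_
  -- For p even, the differential leaving degree p + 1 is the identity and the cocycle is locally
  -- zero; for p odd, the differential arriving there is the identity.
  by_cases h : Even p
  · refine nullCochains_le_coboundaries _ (mem_nullCochains_discrete.2 fun s => ?_)
    have := mem_nullCochains_discrete.1 hφ.2 s
    rwa [coboundary_const, if_neg (by simp [Nat.even_add_one, h])] at this
  · refine mem_coboundaries_succ.2 ⟨fun x => φ fun _ => x 0, mem_compactlySupported_finite _, ?_⟩
    refine mem_nullCochains_discrete.2 fun s => ?_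
    rw [Pi.sub_apply, coboundary_const, if_neg h, sub_self]

end Discrete

end AlexanderSpanier

namespace AlexanderSpanier

/-! ### Prism operators and their chain homotopy formula -/

section Prism

/-- Here `A i j` stands for the j-th face of the i-th simplex of the prism, `B j i` for the i-th
simplex of the prism over the j-th face, and `e i` for the face shared by the simplices i - 1 and i.
Faces with j < i or j > i + 1 cancel against `B`; those with j = i, i + 1 telescope. -/
theorem prism_sum_identity (p : ℕ) (A B : ℕ → ℕ → ℤ) (e : ℕ → ℤ)
    (h1 : ∀ i j, j ≤ i → A (i + 1) j = B j i) (h2 : ∀ i j, i < j → A i (j + 1) = B j i)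
    (h3 : ∀ i, A i i = e i) (h4 : ∀ i, A i (i + 1) = e (i + 1)) :
    ∑ j ∈ Finset.range (p + 1), (-1) ^ j * ∑ i ∈ Finset.range p, (-1) ^ i * B j i
      + ∑ i ∈ Finset.range (p + 1), (-1) ^ i * ∑ j ∈ Finset.range (p + 2), (-1) ^ j * A i j
      = e 0 - e (p + 1) := by
  have split : ∀ i ∈ Finset.range (p + 1),
      (-1 : ℤ) ^ i * ∑ j ∈ Finset.range (p + 2), (-1) ^ j * A i j =
      ∑ j ∈ Finset.range i, (-1) ^ (i + j) * A i j + (e i - e (i + 1))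
        - ∑ j ∈ Finset.Ico (i + 1) (p + 1), (-1) ^ (i + j) * B j i := by
    intro i hi
    have hi : i ≤ p := by simpa [Nat.lt_succ_iff] using hi
    rw [← Finset.sum_range_add_sum_Ico _ (show i ≤ p + 2 by omega),
      Finset.sum_eq_sum_Ico_succ_bot (show i < p + 2 by omega),
      Finset.sum_eq_sum_Ico_succ_bot (show i + 1 < p + 2 by omega),
      ← Finset.sum_Ico_add' _ (i + 1) (p + 1) 1, h3, h4, mul_add, mul_add, mul_add,
      Finset.mul_sum, Finset.mul_sum]
    have hs : ((-1 : ℤ) ^ i) * (-1) ^ i = 1 := by rw [← pow_add, Even.neg_one_pow ⟨i, rfl⟩]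
    have e1 : ∑ j ∈ Finset.Ico (i + 1) (p + 1), (-1 : ℤ) ^ i * ((-1) ^ (j + 1) * A i (j + 1)) =
        - ∑ j ∈ Finset.Ico (i + 1) (p + 1), (-1) ^ (i + j) * B j i := by
      rw [← Finset.sum_neg_distrib]
      refine Finset.sum_congr rfl fun j hj => ?_
      rw [h2 i j (Finset.mem_Ico.1 hj).1]
      ring
    rw [e1]
    have e2 : ∑ j ∈ Finset.range i, (-1 : ℤ) ^ i * ((-1) ^ j * A i j) =
        ∑ j ∈ Finset.range i, (-1) ^ (i + j) * A i j :=
      Finset.sum_congr rfl fun j _ => by ring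
    rw [e2]
    linear_combination (e i - e (i + 1)) * hs
  rw [Finset.sum_congr rfl split, Finset.sum_sub_distrib, Finset.sum_add_distrib,
    Finset.sum_range_sub', Finset.sum_range_succ' (fun i =>
      ∑ j ∈ Finset.range i, (-1 : ℤ) ^ (i + j) * A i j), Finset.sum_range_succ (fun i =>
      ∑ j ∈ Finset.Ico (i + 1) (p + 1), (-1 : ℤ) ^ (i + j) * B j i)]
  have e3 : ∑ j ∈ Finset.range (p + 1), (-1 : ℤ) ^ j * ∑ i ∈ Finset.range p, (-1) ^ i * B j i =
      ∑ i ∈ Finset.range p, ∑ j ∈ Finset.range (p + 1), (-1) ^ (i + j) * B j i := by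
    rw [Finset.sum_comm']
    · refine Finset.sum_congr rfl fun j _ => ?_
      rw [Finset.mul_sum]
      exact Finset.sum_congr rfl fun i _ => by ring
    · exact fun x y => Iff.rfl
  have e4 : ∀ i ∈ Finset.range p,
      ∑ j ∈ Finset.range (p + 1), (-1 : ℤ) ^ (i + j) * B j i =
      - ∑ j ∈ Finset.range (i + 1), (-1) ^ (i + 1 + j) * A (i + 1) j +
        ∑ j ∈ Finset.Ico (i + 1) (p + 1), (-1) ^ (i + j) * B j i := by
    intro i hi
    have hi := Finset.mem_range.1 hi
    rw [← Finset.sum_range_add_sum_Ico _ (show i + 1 ≤ p + 1 by omega)]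
    congr 1
    rw [← Finset.sum_neg_distrib]
    refine Finset.sum_congr rfl fun j hj => ?_
    rw [h1 i j (by have := Finset.mem_range.1 hj; omega)]
    ring
  rw [e3, Finset.sum_congr rfl e4, Finset.sum_add_distrib, Finset.sum_neg_distrib]
  simp

variable {X Y : Type}

/-- The vertices `f x₀, …, f xᵢ, g xᵢ, …, g xₚ`. -/
def prismVertex (f g : X → Y) {p : ℕ} (x : Fin (p + 1) → X) (i : Fin (p + 1)) :
    Fin (p + 2) → Y :=
  fun j => if j ≤ i.castSucc then f (x (i.predAbove j)) else g (x (i.predAbove j))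

theorem prismVertex_zero (f g : X → Y) {p : ℕ} (x : Fin (p + 1) → X) (i : Fin (p + 1)) :
    prismVertex f g x i 0 = f (x 0) := by
  simp [prismVertex]

theorem exists_prismVertex (f g : X → Y) {p : ℕ} (x : Fin (p + 1) → X) (i : Fin (p + 1))
    (j : Fin (p + 2)) : ∃ l, prismVertex f g x i j = f (x l) ∨ prismVertex f g x i j = g (x l) := by
  refine ⟨i.predAbove j, ?_⟩
  unfold prismVertex
  split_ifs <;> simp

/-- The prism operator, a chain homotopy between the pullbacks along two maps. -/
def prism (f g : X → Y) (p : ℕ) (φ : Cochain Y (p + 1)) : Cochain X p :=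
  fun x => ∑ i : Fin (p + 1), (-1) ^ (i : ℕ) * φ (prismVertex f g x i)

/-- The sequence `a` with its `j`-th term left out. -/
def skip (j l : ℕ) : ℕ := if l < j then l else l + 1

/-- Tuples are replaced by sequences indexed by `ℕ`, so that identities between faces become
arithmetic of indices within reach of `omega`. -/
theorem exists_extension [Nonempty X] {p : ℕ} (x : Fin p → X) :
    ∃ a : ℕ → X, x = fun i : Fin p => a i :=
  ⟨fun n => if h : n < p then x ⟨n, h⟩ else Classical.arbitrary X, by ext i; simp⟩

theorem coboundary_seq {p : ℕ} (φ : Cochain X p) (a : ℕ → X) :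
    coboundary X p φ (fun i => a i) =
      ∑ j ∈ Finset.range (p + 2), (-1) ^ j * φ (fun l => a (skip j l)) := by
  rw [coboundary_apply, ← Fin.sum_univ_eq_sum_range
    (fun j => (-1) ^ j * φ (fun l => a (skip j l)))]
  refine Finset.sum_congr rfl fun i _ => ?_
  congr 2
  ext l
  simp only [Function.comp_apply, skip, Fin.succAbove, Fin.lt_def]
  split_ifs <;> simp_all

theorem prism_seq (f g : X → Y) {p : ℕ} (φ : Cochain Y (p + 1)) (a : ℕ → X) :
    prism f g p φ (fun i => a i) = ∑ i ∈ Finset.range (p + 1), (-1) ^ i *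
      φ (fun l => if (l : ℕ) ≤ i then f (a l) else g (a (l - 1))) := by
  rw [← Fin.sum_univ_eq_sum_range (fun i => (-1) ^ i *
      φ (fun l => if (l : ℕ) ≤ i then f (a l) else g (a (l - 1))))]
  refine Finset.sum_congr rfl fun i _ => ?_
  congr 2
  ext l
  simp only [prismVertex, Fin.le_def, Fin.val_castSucc, Fin.predAbove, Fin.lt_def]
  split_ifs <;> first | omega | simp

theorem coboundary_prism_add (f g : X → Y) {p : ℕ} (φ : Cochain Y (p + 1))
    (x : Fin (p + 2) → X) :
    coboundary X p (prism f g p φ) x + prism f g (p + 1) (coboundary Y (p + 1) φ) x =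
      φ (g ∘ x) - φ (f ∘ x) := by
  have : Nonempty X := ⟨x 0⟩
  obtain ⟨a, rfl⟩ := exists_extension x
  rw [coboundary_seq, prism_seq]
  have := prism_sum_identity (p + 1)
    (fun i j => φ (fun l => if skip j l ≤ i then f (a (skip j l)) else g (a (skip j l - 1))))
    (fun j i => φ (fun l => if (l : ℕ) ≤ i then f (a (skip j l)) else g (a (skip j (l - 1)))))
    (fun i => φ (fun l => if (l : ℕ) < i then f (a l) else g (a l))) ?_ ?_ ?_ ?_
  · convert this using 2
    · refine Finset.sum_congr rfl fun j _ => ?_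
      congr 1
      exact prism_seq f g φ (fun l => a (skip j l))
    · refine Finset.sum_congr rfl fun i _ => ?_
      congr 1
      exact coboundary_seq φ (fun l => if l ≤ i then f (a l) else g (a (l - 1)))
    · simp [Function.comp_def]
    · congr 1
      ext l
      have := l.2
      simp only [Function.comp_apply]
      rw [if_pos (by omega)]
  all_goals
    intros
    congr 1
    ext l
    simp only [skip]
    split_ifs <;> first | omega | rfl | (congr 2; omega)

theorem prism_coboundary_zero (f g : X → Y) (φ : Cochain Y 0) (x : Fin 1 → X) :
    prism f g 0 (coboundary Y 0 φ) x = φ (g ∘ x) - φ (f ∘ x) := by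
  have h : ∀ a b : Fin 1 → Y, a 0 = b 0 → φ a = φ b := fun a b hab =>
    congrArg φ (funext fun i => by rw [Subsingleton.elim i 0, hab])
  have h0 := h (prismVertex f g x 0 ∘ Fin.succ) (g ∘ x) (by simp [prismVertex])
  have h1 := h (prismVertex f g x 0 ∘ Fin.succAbove 1) (f ∘ x) (by simp [prismVertex])
  simp [prism, coboundary_apply, Fin.sum_univ_succ, h0, h1, sub_eq_add_neg]

/-- Every simplex of the prism starts at `f (x 0)`. Keeping this in the hypothesis lets vanishing
conditions on the first vertex pass through the prism operator. -/
theorem prism_eq_zero {f g : X → Y} {p : ℕ} {φ : Cochain Y (p + 1)} {x : Fin (p + 1) → X}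
    (h : ∀ z : Fin (p + 2) → Y, z 0 = f (x 0) → (∀ j, ∃ l, z j = f (x l) ∨ z j = g (x l)) →
      φ z = 0) :
    prism f g p φ x = 0 :=
  Finset.sum_eq_zero fun i _ => by
    rw [h _ (prismVertex_zero f g x i) (exists_prismVertex f g x i), mul_zero]

/-- The sum of the prism operators along a sequence of maps. -/
def prismPath (s : ℕ → X → Y) (M p : ℕ) (φ : Cochain Y (p + 1)) : Cochain X p :=
  fun x => ∑ i ∈ Finset.range M, prism (s i) (s (i + 1)) p φ x

theorem prismPath_eq_zero {s : ℕ → X → Y} {M p : ℕ} {φ : Cochain Y (p + 1)}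
    {x : Fin (p + 1) → X}
    (h : ∀ i < M, ∀ z : Fin (p + 2) → Y, z 0 = s i (x 0) →
      (∀ j, ∃ l, z j = s i (x l) ∨ z j = s (i + 1) (x l)) → φ z = 0) :
    prismPath s M p φ x = 0 :=
  Finset.sum_eq_zero fun i hi => prism_eq_zero (h i (Finset.mem_range.1 hi))

/-- The homotopy formulas of the single steps telescope. A locally zero coboundary vanishes only on
small simplices, which is why a homotopy is cut into many short steps. -/
theorem coboundary_prismPath {s : ℕ → X → Y} {M p : ℕ} {φ : Cochain Y (p + 1)}
    {x : Fin (p + 2) → X}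
    (h : ∀ i < M, ∀ z : Fin (p + 3) → Y, (∀ j, ∃ l, z j = s i (x l) ∨ z j = s (i + 1) (x l)) →
      coboundary Y (p + 1) φ z = 0) :
    coboundary X p (prismPath s M p φ) x = φ (s M ∘ x) - φ (s 0 ∘ x) := by
  have e : prismPath s M p φ = ∑ i ∈ Finset.range M, prism (s i) (s (i + 1)) p φ := by
    ext x
    simp [prismPath]
  rw [e, map_sum, Finset.sum_apply, ← Finset.sum_range_sub (fun i => φ (s i ∘ x))]
  refine Finset.sum_congr rfl fun i hi => ?_
  rw [← coboundary_prism_add, prism_eq_zero fun z _ hz => h i (Finset.mem_range.1 hi) z hz,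
    add_zero]

theorem apply_path_eq {s : ℕ → X → Y} {M : ℕ} {φ : Cochain Y 0} {x : Fin 1 → X}
    (h : ∀ i < M, ∀ z : Fin 2 → Y, (∀ j, ∃ l, z j = s i (x l) ∨ z j = s (i + 1) (x l)) →
      coboundary Y 0 φ z = 0) :
    φ (s M ∘ x) = φ (s 0 ∘ x) := by
  rw [← sub_eq_zero, ← Finset.sum_range_sub (fun i => φ (s i ∘ x))]
  refine Finset.sum_eq_zero fun i hi => ?_
  rw [← prism_coboundary_zero, prism_eq_zero fun z _ hz => h i (Finset.mem_range.1 hi) z hz]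

end Prism

end AlexanderSpanier

namespace AlexanderSpanier

/-! ### Representatives carried by compact sets, and uniform smallness -/

section Carried

variable {X : Type} [TopologicalSpace X]

/-- The support only sees tuples near the diagonal. Cutting the cochain down to tuples in a compact
neighbourhood of the support changes it by a locally zero cochain and makes it vanish outright
elsewhere. -/
theorem exists_carried_representative [LocallyCompactSpace X] {p : ℕ} {φ : Cochain X p}
    (h : φ ∈ compactlySupported X p) :
    ∃ K, IsCompact K ∧ ∃ φ' : Cochain X p, (∀ x, (∃ i, x i ∉ K) → φ' x = 0) ∧
      φ - φ' ∈ nullCochains X p := by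
  classical
  obtain ⟨K, hK, hs⟩ := exists_compact_superset (mem_compactlySupported.1 h)
  refine ⟨K, hK, fun x => if ∀ i, x i ∈ K then φ x else 0, ?_, ?_⟩
  · rintro x ⟨i, hi⟩
    exact if_neg fun hx => hi (hx i)
  · refine mem_nullCochains_iff.2 fun x => ?_
    by_cases hx : x ∈ support φ
    · refine ⟨interior K, isOpen_interior.mem_nhds (hs hx), fun y hy => ?_⟩
      rw [Pi.sub_apply, if_pos fun i => interior_subset (hy i), sub_self]
    · obtain ⟨U, hU, hU'⟩ := notMem_support.1 hx
      refine ⟨U, hU, fun y hy => ?_⟩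
      rw [Pi.sub_apply, hU' y hy]
      simp

theorem support_subset_of_forall_zero {p : ℕ} {φ : Cochain X p} {K : Set X} (hK : IsClosed K)
    (h : ∀ x, x 0 ∉ K → φ x = 0) : support φ ⊆ K := by
  intro x hx
  by_contra hxK
  exact notMem_support.2 ⟨Kᶜ, hK.isOpen_compl.mem_nhds hxK, fun y hy => h y (hy 0)⟩ hx

theorem mem_compactlySupported_of_forall_zero [T2Space X] {p : ℕ} {φ : Cochain X p} {K : Set X}
    (hK : IsCompact K) (h : ∀ x, x 0 ∉ K → φ x = 0) : φ ∈ compactlySupported X p :=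
  hK.of_isClosed_subset (isClosed_support _) (support_subset_of_forall_zero hK.isClosed h)

end Carried

section Metric

variable {X : Type} [PseudoMetricSpace X]

/-- A Lebesgue number of the cover by neighbourhoods of vanishing makes local vanishing uniform. One
vertex in `K` suffices, because the others lie in the δ-ball around it. -/
theorem exists_lebesgue_number {p : ℕ} {φ : Cochain X p} (h : φ ∈ nullCochains X p) {K : Set X}
    (hK : IsCompact K) :
    ∃ δ > 0, ∀ x : Fin (p + 1) → X, (∀ i j, dist (x i) (x j) < δ) → (∃ i, x i ∈ K) → φ x = 0 := by
  choose U hU hφ using mem_nullCochains_iff.1 h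
  obtain ⟨δ, hδ, hL⟩ := lebesgue_number_lemma_of_metric (c := fun x => interior (U x)) hK
    (fun x => isOpen_interior)
    (fun x _ => Set.mem_iUnion.2 ⟨x, mem_interior_iff_mem_nhds.2 (hU x)⟩)
  refine ⟨δ, hδ, fun x hx ⟨i, hi⟩ => ?_⟩
  obtain ⟨y, hy⟩ := hL _ hi
  exact hφ y x fun j => interior_subset (hy (hx j i))

theorem mem_nullCochains_of_dist {p : ℕ} {φ : Cochain X p} {δ : ℝ} (hδ : 0 < δ)
    (h : ∀ x : Fin (p + 1) → X, (∀ i j, dist (x i) (x j) < δ) → φ x = 0) :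
    φ ∈ nullCochains X p := by
  refine mem_nullCochains_iff.2 fun x => ⟨Metric.ball x (δ / 2), Metric.ball_mem_nhds x (by linarith),
    fun y hy => h y fun i j => ?_⟩
  have h1 := Metric.mem_ball.1 (hy i)
  have h2 := Metric.mem_ball.1 (hy j)
  have h3 := dist_triangle_right (y i) (y j) x
  linarith

theorem coboundary_eq_zero_of_forall {X : Type} {p : ℕ} {φ : Cochain X p}
    {z : Fin (p + 2) → X} (h : ∀ w : Fin (p + 1) → X, (∀ i, ∃ j, w i = z j) → φ w = 0) :
    coboundary X p φ z = 0 := by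
  rw [coboundary_apply]
  exact Finset.sum_eq_zero fun i _ => by
    rw [h (z ∘ i.succAbove) fun j => ⟨i.succAbove j, rfl⟩, mul_zero]

end Metric

/-! ### The suspension of cochains -/

section Suspension

variable {X : Type}

/-- The characteristic function of the half space `t ≥ 0` of `X × ℝ`. -/
noncomputable def heaviside (y : X × ℝ) : ℤ := if 0 ≤ y.2 then 1 else 0

/-- Multiplication of a cochain by the characteristic function of `t ≥ 0` at the first vertex. -/
noncomputable def cut (X : Type) (p : ℕ) : Cochain (X × ℝ) p →ₗ[ℤ] Cochain (X × ℝ) p where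
  toFun φ := fun y => heaviside (y 0) * φ y
  map_add' φ ψ := by
    ext y
    simp [mul_add]
  map_smul' c φ := by
    ext y
    simp [mul_left_comm]

/-- The suspension of cochains: the exterior product with the coboundary of the characteristic
function of the half line. -/
noncomputable def suspension (X : Type) (p : ℕ) : Cochain X p →ₗ[ℤ] Cochain (X × ℝ) (p + 1) :=
  coboundary (X × ℝ) p ∘ₗ cut X p ∘ₗ pullback Prod.fst p -
    cut X (p + 1) ∘ₗ pullback Prod.fst (p + 1) ∘ₗ coboundary X p

theorem suspension_eq {p : ℕ} (ψ : Cochain X p) :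
    suspension X p ψ = coboundary (X × ℝ) p (cut X p (pullback Prod.fst p ψ)) -
      cut X (p + 1) (pullback Prod.fst (p + 1) (coboundary X p ψ)) := rfl

/-- The faces that keep vertex 0 cancel between the two summands of the definition. What remains is
a product with the coboundary of the Heaviside function, hence is concentrated at height 0. -/
theorem suspension_apply {p : ℕ} (ψ : Cochain X p) (y : Fin (p + 2) → X × ℝ) :
    suspension X p ψ y =
      (heaviside (y 1) - heaviside (y 0)) * ψ (fun i => (y i.succ).1) := by
  have h0 : ∀ i : Fin (p + 1), (y ∘ (i.succ).succAbove) 0 = y 0 := fun i => by simp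
  change ∑ i : Fin (p + 2), (-1) ^ (i : ℕ) *
      (heaviside ((y ∘ i.succAbove) 0) * ψ (Prod.fst ∘ y ∘ i.succAbove)) -
    heaviside (y 0) * ∑ i : Fin (p + 2), (-1) ^ (i : ℕ) * ψ ((Prod.fst ∘ y) ∘ i.succAbove) = _
  rw [Fin.sum_univ_succ, Fin.sum_univ_succ (fun i : Fin (p + 2) =>
    (-1 : ℤ) ^ (i : ℕ) * ψ ((Prod.fst ∘ y) ∘ i.succAbove)), mul_add, Finset.mul_sum]
  simp only [h0]
  have h1 : (y ∘ Fin.succAbove 0) 0 = y 1 := by simp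
  have h2 : ψ (Prod.fst ∘ y ∘ Fin.succAbove 0) = ψ (fun i => (y i.succ).1) := by
    congr 1
  have h3 : ψ ((Prod.fst ∘ y) ∘ Fin.succAbove 0) = ψ (fun i => (y i.succ).1) := by
    congr 1
  rw [h1, h2, h3, Finset.sum_congr rfl fun i _ => mul_left_comm ((-1 : ℤ) ^ (i.succ : ℕ))
    (heaviside (y 0)) _]
  simp only [Fin.val_zero, pow_zero, one_mul, Function.comp_assoc]
  ring

theorem coboundary_suspension {p : ℕ} (ψ : Cochain X p) :
    coboundary (X × ℝ) (p + 1) (suspension X p ψ) = - suspension X (p + 1) (coboundary X p ψ) := by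
  rw [suspension_eq, suspension_eq, map_sub, coboundary_coboundary, coboundary_coboundary]
  simp

variable [TopologicalSpace X]

theorem cut_mem_nullCochains {p : ℕ} {φ : Cochain (X × ℝ) p} (h : φ ∈ nullCochains (X × ℝ) p) :
    cut X p φ ∈ nullCochains (X × ℝ) p := by
  refine mem_nullCochains_iff.2 fun y => ?_
  obtain ⟨U, hU, hz⟩ := mem_nullCochains_iff.1 h y
  refine ⟨U, hU, fun z hz' => ?_⟩
  change heaviside (z 0) * φ z = 0
  rw [hz z hz', mul_zero]

theorem support_suspension {p : ℕ} (ψ : Cochain X p) :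
    support (suspension X p ψ) ⊆ support ψ ×ˢ {0} := by
  intro y hy
  by_contra h
  rw [Set.mem_prod, not_and_or] at h
  refine notMem_support.2 ?_ hy
  rcases h with h | h
  · obtain ⟨U, hU, hz⟩ := notMem_support.1 h
    refine ⟨_, continuous_fst.continuousAt hU, fun z hz' => ?_⟩
    rw [suspension_apply, hz _ fun i => hz' i.succ, mul_zero]
  · rcases lt_or_gt_of_ne (show y.2 ≠ 0 from h) with h | h
    · refine ⟨{z | z.2 < 0}, (isOpen_lt continuous_snd continuous_const).mem_nhds h,
        fun z hz => ?_⟩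
      have h0 : heaviside (z 0) = 0 := if_neg (not_le.2 (hz 0))
      have h1 : heaviside (z 1) = 0 := if_neg (not_le.2 (hz 1))
      rw [suspension_apply, h0, h1, sub_self, zero_mul]
    · refine ⟨{z | 0 < z.2}, (isOpen_lt continuous_const continuous_snd).mem_nhds h,
        fun z hz => ?_⟩
      have h0 : heaviside (z 0) = 1 := if_pos (le_of_lt (hz 0))
      have h1 : heaviside (z 1) = 1 := if_pos (le_of_lt (hz 1))
      rw [suspension_apply, h0, h1, sub_self, zero_mul]

theorem suspension_mem_nullCochains {p : ℕ} {ψ : Cochain X p} (h : ψ ∈ nullCochains X p) :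
    suspension X p ψ ∈ nullCochains (X × ℝ) (p + 1) := by
  have := support_suspension ψ
  rw [mem_nullCochains.1 h, Set.empty_prod] at this
  exact Set.subset_empty_iff.1 this

theorem suspension_mem_compactlySupported {p : ℕ} {ψ : Cochain X p}
    (h : ψ ∈ compactlySupported X p) :
    suspension X p ψ ∈ compactlySupported (X × ℝ) (p + 1) :=
  (IsCompact.prod h isCompact_singleton).of_isClosed_subset (isClosed_support _)
    (support_suspension ψ)

theorem suspension_mem_cocycles {p : ℕ} {ψ : Cochain X p} (h : ψ ∈ cocycles X p) :
    suspension X p ψ ∈ cocycles (X × ℝ) (p + 1) := by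
  refine mem_cocycles.2 ⟨suspension_mem_compactlySupported h.1, ?_⟩
  rw [coboundary_suspension]
  exact Submodule.neg_mem _ (suspension_mem_nullCochains h.2)

theorem suspension_mem_coboundaries {p : ℕ} {ψ : Cochain X p} (h : ψ ∈ coboundaries X p) :
    suspension X p ψ ∈ coboundaries (X × ℝ) (p + 1) := by
  cases p with
  | zero => exact nullCochains_le_coboundaries _ (suspension_mem_nullCochains h)
  | succ p =>
    obtain ⟨η, hη, h⟩ := mem_coboundaries_succ.1 h
    refine mem_coboundaries_succ.2 ⟨- suspension X p η,
      Submodule.neg_mem _ (suspension_mem_compactlySupported hη), ?_⟩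
    rw [map_neg, coboundary_suspension, neg_neg, ← map_sub]
    exact suspension_mem_nullCochains h

end Suspension

end AlexanderSpanier

namespace AlexanderSpanier

/-! ### The suspension isomorphism -/

section Descent

variable {X : Type} [MetricSpace X]

theorem dist_path_lt {Z W : Type} [PseudoMetricSpace Z] [PseudoMetricSpace W] {δ : ℝ} {p q : ℕ}
    {f g : Z → W}
    {x : Fin p → Z} {z : Fin q → W} (hx : ∀ i j, dist (x i) (x j) < δ / 2)
    (hff : ∀ a b, dist (f a) (f b) ≤ dist a b) (hgg : ∀ a b, dist (g a) (g b) ≤ dist a b)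
    (hfg : ∀ a, dist (f a) (g a) ≤ δ / 2)
    (hz : ∀ j, ∃ l, z j = f (x l) ∨ z j = g (x l)) (i j : Fin q) : dist (z i) (z j) < δ := by
  obtain ⟨k, hk⟩ := hz i
  obtain ⟨l, hl⟩ := hz j
  have hkl := hx k l
  have h0 : 0 ≤ dist (x k) (x l) := dist_nonneg
  have hf := hff (x k) (x l)
  have hg := hgg (x k) (x l)
  have h1 := hfg (x l)
  have h2 := hfg (x k)
  have h3 := dist_triangle (f (x k)) (f (x l)) (g (x l))
  have h4 := dist_triangle_left (g (x k)) (f (x l)) (f (x k))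
  rcases hk with hk | hk <;> rcases hl with hl | hl <;> rw [hk, hl] <;> linarith

/-- The embedding of `X` as the slice at height `min (a + iδ) b` of `X × ℝ`. -/
def slice (a b δ : ℝ) (i : ℕ) (x : X) : X × ℝ := (x, min (a + i * δ) b)

theorem dist_slice_slice_le (a b δ : ℝ) (i : ℕ) (x y : X) :
    dist (slice a b δ i x) (slice a b δ i y) ≤ dist x y := by
  simp [slice, Prod.dist_eq]

theorem dist_slice_succ_le (a b : ℝ) {δ : ℝ} (hδ : 0 ≤ δ) (i : ℕ) (x : X) :
    dist (slice a b δ i x) (slice a b δ (i + 1) x) ≤ δ := by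
  simp only [slice, Prod.dist_eq, dist_self, Real.dist_eq]
  refine max_le hδ ((abs_min_sub_min_le_max _ _ _ _).trans (max_le ?_ (by simpa using hδ)))
  push_cast
  rw [show a + i * δ - (a + (i + 1) * δ) = -δ by ring, abs_neg, abs_of_nonneg hδ]

/-- The map of `X × ℝ` that lowers to height `a - iδ` all points above that height. -/
def lower (a δ : ℝ) (i : ℕ) (y : X × ℝ) : X × ℝ := (y.1, min y.2 (a - i * δ))

theorem dist_lower_lower_le (a δ : ℝ) (i : ℕ) (y z : X × ℝ) :
    dist (lower a δ i y) (lower a δ i z) ≤ dist y z := by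
  simp only [lower, Prod.dist_eq, Real.dist_eq]
  refine max_le_max le_rfl ((abs_min_sub_min_le_max _ _ _ _).trans ?_)
  simp

theorem dist_lower_succ_le (a : ℝ) {δ : ℝ} (hδ : 0 ≤ δ) (i : ℕ) (y : X × ℝ) :
    dist (lower a δ i y) (lower a δ (i + 1) y) ≤ δ := by
  simp only [lower, Prod.dist_eq, dist_self, Real.dist_eq]
  refine max_le hδ ((abs_min_sub_min_le_max _ _ _ _).trans (max_le (by simpa using hδ) ?_))
  push_cast
  rw [show a - i * δ - (a - (i + 1) * δ) = δ by ring, abs_of_nonneg hδ]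

theorem exists_height_bound {K : Set (X × ℝ)} (hK : IsCompact K) :
    ∃ T > 0, ∀ y ∈ K, -T < y.2 ∧ y.2 < T := by
  obtain ⟨R, hR⟩ := (hK.image continuous_snd).isBounded.exists_norm_le
  refine ⟨|R| + 1, by positivity, fun y hy => abs_lt.1 ?_⟩
  have := hR _ (Set.mem_image_of_mem _ hy)
  rw [Real.norm_eq_abs] at this
  linarith [le_abs_self R]

variable [LocallyCompactSpace X]

/-- Injectivity of suspension. If the suspension of ψ is the coboundary of η, then θ, the Heaviside
function times ψ minus η, is a cocycle on X × ℝ that restricts to 0 on slices below the carrier of η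
and to ψ on slices above it. Sliding a slice from bottom to top in short steps exhibits ψ as a
coboundary (all up to locally zero cochains). -/
theorem mem_coboundaries_of_suspension {p : ℕ} {ψ : Cochain X p} (hψ : ψ ∈ cocycles X p)
    (h : suspension X p ψ ∈ coboundaries (X × ℝ) (p + 1)) : ψ ∈ coboundaries X p := by
  obtain ⟨η, hη, hS⟩ := mem_coboundaries_succ.1 h
  obtain ⟨K₀, hK₀, ψ', hψ', hψψ'⟩ := exists_carried_representative hψ.1
  obtain ⟨K, hK, η', hη', hηη'⟩ := exists_carried_representative hη
  obtain ⟨T, hT, hKT⟩ := exists_height_bound hK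
  have hdψ' : coboundary X p ψ' ∈ nullCochains X (p + 1) := by
    have := Submodule.sub_mem _ (mem_cocycles.1 hψ).2 (coboundary_mem_nullCochains hψψ')
    rwa [map_sub, sub_sub_cancel] at this
  set K₁ := K₀ ∪ Prod.fst '' K with hK₁_def
  have hK₁ : IsCompact K₁ := hK₀.union (hK.image continuous_fst)
  set θ : Cochain (X × ℝ) p := cut X p (pullback Prod.fst p ψ') - η' with hθ_def
  have hθ : coboundary (X × ℝ) p θ ∈ nullCochains (X × ℝ) (p + 1) := by
    have h1 := suspension_mem_nullCochains hψψ'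
    have h2 := coboundary_mem_nullCochains hηη'
    have h3 := cut_mem_nullCochains (pullback_mem_nullCochains continuous_fst hdψ')
    have h4 := Submodule.add_mem _ (Submodule.add_mem _ (Submodule.sub_mem _ hS h1) h2) h3
    convert h4 using 1
    rw [map_sub, map_sub (suspension X p), map_sub (coboundary (X × ℝ) p), suspension_eq ψ']
    abel
  have hθ_apply : ∀ y, θ y = heaviside (y 0) * ψ' (Prod.fst ∘ y) - η' y := fun y => rfl
  have hθ0 : ∀ y, (y 0).1 ∉ K₁ → θ y = 0 := by
    intro y hy
    rw [hθ_apply, hψ' _ ⟨0, fun h => hy (Or.inl h)⟩,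
      hη' _ ⟨0, fun h => hy (Or.inr ⟨_, h, rfl⟩)⟩, mul_zero, sub_zero]
  obtain ⟨δ, hδ, hδ'⟩ := exists_lebesgue_number hθ (hK₁.prod (isCompact_Icc (a := -T) (b := T)))
  -- Compactness yields a uniform δ only over `K₁`; for a simplex with no vertex over `K₁`, θ
  -- vanishes on every face.
  have hsmall : ∀ z : Fin (p + 2) → X × ℝ, (∀ i j, dist (z i) (z j) < δ) →
      (∀ i, (z i).2 ∈ Set.Icc (-T) T) → coboundary (X × ℝ) p θ z = 0 := by
    intro z hz hzT
    by_cases hz1 : ∃ i, (z i).1 ∈ K₁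
    · obtain ⟨i, hi⟩ := hz1
      exact hδ' z hz ⟨i, hi, hzT i⟩
    · refine coboundary_eq_zero_of_forall fun w hw => hθ0 w fun hw1 => hz1 ?_
      obtain ⟨j, hj⟩ := hw 0
      exact ⟨j, hj ▸ hw1⟩
  -- Enough steps of length δ/2 to climb from -T to T; the minimum in `slice` stops the climb at T.
  obtain ⟨M, hM⟩ := exists_nat_ge (2 * T / (δ / 2))
  have hM' : 2 * T ≤ M * (δ / 2) := (div_le_iff₀ (by linarith)).1 hM
  set s : ℕ → X → X × ℝ := slice (-T) T (δ / 2)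
  have hs0 : ∀ x, s 0 x = (x, -T) := fun x => by
    change (x, min (-T + (0 : ℕ) * (δ / 2)) T) = (x, -T)
    rw [min_eq_left] <;> simp; linarith
  have hsM : ∀ x, s M x = (x, T) := fun x => by
    change (x, min (-T + M * (δ / 2)) T) = (x, T)
    rw [min_eq_right]
    linarith
  have hsT : ∀ i x, (s i x).2 ∈ Set.Icc (-T) T := fun i x => by
    refine ⟨le_min ?_ (by linarith), min_le_right _ _⟩
    have : 0 ≤ i * (δ / 2) := by positivity
    linarith
  have hpath : ∀ {q : ℕ} {x : Fin q → X}, (∀ i j, dist (x i) (x j) < δ / 2) → ∀ i,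
      ∀ z : Fin (p + 2) → X × ℝ, (∀ j, ∃ l, z j = s i (x l) ∨ z j = s (i + 1) (x l)) →
        coboundary (X × ℝ) p θ z = 0 := by
    intro q x hx i z hz
    refine hsmall z (dist_path_lt hx (dist_slice_slice_le _ _ _ i) (dist_slice_slice_le _ _ _ _)
      (dist_slice_succ_le _ _ (by linarith) i) hz) fun j => ?_
    obtain ⟨l, h | h⟩ := hz j <;> rw [h] <;> exact hsT _ _
  have hθ_bot : ∀ x : Fin (p + 1) → X, θ (s 0 ∘ x) = 0 := by
    intro x
    rw [hθ_apply, hη' _ ⟨0, fun h => ?_⟩]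
    · have : heaviside ((s 0 ∘ x) 0) = 0 := if_neg (by simp [hs0, hT])
      rw [this, zero_mul, sub_zero]
    · have := (hKT _ h).1
      simp [hs0] at this
  have hθ_top : ∀ x : Fin (p + 1) → X, θ (s M ∘ x) = ψ' x := by
    intro x
    rw [hθ_apply, hη' _ ⟨0, fun h => ?_⟩]
    · have : heaviside ((s M ∘ x) 0) = 1 := if_pos (by simp [hsM, hT.le])
      rw [this, one_mul, sub_zero]
      rfl
    · have := (hKT _ h).2
      simp [hsM] at this
  cases p with
  | zero =>
    have : ψ' ∈ nullCochains X 0 := by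
      refine mem_nullCochains_of_dist (half_pos hδ) fun x hx => ?_
      rw [← hθ_top, apply_path_eq (s := s) fun i _ => hpath hx i, hθ_bot]
    have := Submodule.add_mem _ hψψ' this
    rwa [sub_add_cancel] at this
  | succ p =>
    refine mem_coboundaries_succ.2 ⟨prismPath s M p θ, ?_, ?_⟩
    · refine mem_compactlySupported_of_forall_zero hK₁ fun x hx =>
        prismPath_eq_zero fun i _ z hz _ => hθ0 z ?_
      rw [hz]
      exact hx
    · have : ψ' - coboundary X p (prismPath s M p θ) ∈ nullCochains X (p + 1) := by
        refine mem_nullCochains_of_dist (half_pos hδ) fun x hx => ?_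
        rw [Pi.sub_apply, coboundary_prismPath fun i _ => hpath hx i, hθ_top, hθ_bot]
        simp
      have := Submodule.add_mem _ hψψ' this
      rwa [sub_add_sub_cancel] at this

/-- A compactly supported cocycle of `X × ℝ` is, up to locally zero cochains, represented by a
cochain carried by a bounded set and invariant under small deformations. -/
theorem exists_lowering {p : ℕ} {ω : Cochain (X × ℝ) p} (hω : ω ∈ cocycles (X × ℝ) p) :
    ∃ ω' : Cochain (X × ℝ) p, ω - ω' ∈ nullCochains (X × ℝ) p ∧ ∃ K₁ : Set X, IsCompact K₁ ∧
      ∃ T > (0 : ℝ), (∀ y, (∃ i, (y i).1 ∉ K₁ ∨ (y i).2 ≤ -T ∨ T ≤ (y i).2) → ω' y = 0) ∧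
      ∃ δ > (0 : ℝ), ∃ M : ℕ, T + 1 - M * δ ≤ -T ∧
      ∀ {q : ℕ} {x : Fin q → X × ℝ}, (∀ i j, dist (x i) (x j) < δ) → ∀ i,
        ∀ z : Fin (p + 2) → X × ℝ,
        (∀ j, ∃ l, z j = lower (T + 1) δ i (x l) ∨ z j = lower (T + 1) δ (i + 1) (x l)) →
        coboundary (X × ℝ) p ω' z = 0 := by
  obtain ⟨K, hK, ω', hω', hωω'⟩ := exists_carried_representative hω.1
  obtain ⟨T, hT, hKT⟩ := exists_height_bound hK
  have hdω' : coboundary (X × ℝ) p ω' ∈ nullCochains (X × ℝ) (p + 1) := by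
    have := Submodule.sub_mem _ (mem_cocycles.1 hω).2 (coboundary_mem_nullCochains hωω')
    rwa [map_sub, sub_sub_cancel] at this
  obtain ⟨δ, hδ, hδ'⟩ := exists_lebesgue_number hdω' hK
  have hsmall : ∀ z : Fin (p + 2) → X × ℝ, (∀ i j, dist (z i) (z j) < δ) →
      coboundary (X × ℝ) p ω' z = 0 := by
    intro z hz
    by_cases hz1 : ∃ i, z i ∈ K
    · exact hδ' z hz hz1
    · refine coboundary_eq_zero_of_forall fun w hw => hω' w ⟨0, fun hw1 => hz1 ?_⟩
      obtain ⟨j, hj⟩ := hw 0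
      exact ⟨j, hj ▸ hw1⟩
  -- The descent goes from T + 1 to -T or below. Starting at T + 1 instead of T leaves a collar in
  -- which the cochain already vanishes.
  obtain ⟨M, hM⟩ := exists_nat_ge ((2 * T + 1) / (δ / 2))
  have hM' : 2 * T + 1 ≤ M * (δ / 2) := (div_le_iff₀ (by linarith)).1 hM
  refine ⟨ω', hωω', Prod.fst '' K, hK.image continuous_fst, T, hT, ?_, δ / 2, half_pos hδ, M,
    by linarith, ?_⟩
  · rintro y ⟨i, hi⟩
    refine hω' y ⟨i, fun h => ?_⟩
    have := hKT _ h
    rcases hi with hi | hi | hi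
    · exact hi ⟨_, h, rfl⟩
    · linarith
    · linarith
  · intro q x hx i z hz
    exact hsmall z (dist_path_lt hx (dist_lower_lower_le _ _ i) (dist_lower_lower_le _ _ _)
      (dist_lower_succ_le _ (by linarith) i) hz)

/-- A 0-cocycle keeps its value while a point is lowered along ℝ, and far down this value is 0. -/
theorem finrank_cohomology_prod_real_zero :
    Module.finrank ℤ (Cohomology (X × ℝ) 0) = 0 := by
  refine finrank_cohomology_eq_zero fun ω hω => ?_
  obtain ⟨ω', hωω', K₁, hK₁, T, hT, hω', δ, hδ, M, hM, hpath⟩ := exists_lowering hω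
  have : ω' = 0 := by
    ext x
    have h : ω' (lower (T + 1) δ M ∘ x) = ω' (lower (T + 1) δ 0 ∘ x) := by
      refine apply_path_eq fun i _ => hpath (x := x) (fun i j => ?_) i
      rw [Subsingleton.elim (α := Fin 1) i j, dist_self]
      exact hδ
    rw [hω' (lower (T + 1) δ M ∘ x) ⟨0, Or.inr (Or.inl ((min_le_right _ _).trans hM))⟩] at h
    by_contra hx
    refine hx ?_
    have hxT : (x 0).2 < T := by
      by_contra hxT
      exact hx (hω' x ⟨0, Or.inr (Or.inr (not_lt.1 hxT))⟩)
    rw [Pi.zero_apply, h]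
    refine congrArg ω' (funext fun i => ?_)
    rw [Subsingleton.elim (α := Fin 1) i 0]
    refine Prod.ext rfl (Eq.symm (min_eq_left ?_))
    simp
    linarith
  rw [this, sub_zero] at hωω'
  exact hωω'

/-- Surjectivity of suspension. Pushing X × ℝ down below the carrier of ω writes ω as the coboundary
of some η, up to locally zero cochains. The support of η may be unbounded upwards, but above T + 1 η
does not depend on the heights and is pulled back from a cochain ψ on X. Then the Heaviside function
times ψ, minus η, has compact support, and its coboundary is the suspension of ψ minus ω, up to
locally zero cochains. -/
theorem exists_suspension_sub_mem {p : ℕ} {ω : Cochain (X × ℝ) (p + 1)}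
    (hω : ω ∈ cocycles (X × ℝ) (p + 1)) :
    ∃ ψ ∈ cocycles X p, suspension X p ψ - ω ∈ coboundaries (X × ℝ) (p + 1) := by
  obtain ⟨ω', hωω', K₁, hK₁, T, hT, hω', δ, hδ, M, hM, hpath⟩ := exists_lowering hω
  set s : ℕ → X × ℝ → X × ℝ := lower (T + 1) δ with hs_def
  have hs0 : ∀ y : X × ℝ, s 0 y = (y.1, min y.2 (T + 1)) := fun y => by simp [hs_def, lower]
  -- The sign is needed because `coboundary_prismPath` gives the value at the end of the push, here
  -- zero, minus the value at its start.
  set η : Cochain (X × ℝ) p := - prismPath s M p ω' with hη_def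
  have hη : coboundary (X × ℝ) p η - ω' ∈ nullCochains (X × ℝ) (p + 1) := by
    have h1 : coboundary (X × ℝ) p η - pullback (s 0) (p + 1) ω' ∈
        nullCochains (X × ℝ) (p + 1) := by
      refine mem_nullCochains_of_dist hδ fun x hx => ?_
      rw [Pi.sub_apply, hη_def, map_neg, Pi.neg_apply, coboundary_prismPath fun i _ => hpath hx i,
        hω' (s M ∘ x) ⟨0, Or.inr (Or.inl ((min_le_right _ _).trans hM))⟩, pullback_apply]
      simp
    -- The map `s 0` caps heights at T + 1: below T + 1 it is the identity, and above T both
    -- cochains vanish. These two open sets cover X × ℝ.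
    have h2 : pullback (s 0) (p + 1) ω' - ω' ∈ nullCochains (X × ℝ) (p + 1) := by
      refine mem_nullCochains_iff.2 fun y => ?_
      rcases lt_or_ge T y.2 with h | h
      · refine ⟨{z | T < z.2}, (isOpen_lt continuous_const continuous_snd).mem_nhds h,
          fun z hz => ?_⟩
        have hz0 : T < (z 0).2 := hz 0
        rw [Pi.sub_apply, pullback_apply, hω' z ⟨0, Or.inr (Or.inr hz0.le)⟩,
          hω' (s 0 ∘ z) ⟨0, Or.inr (Or.inr ?_)⟩, sub_zero]
        rw [Function.comp_apply, hs0]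
        exact le_min hz0.le (by linarith)
      · refine ⟨{z | z.2 < T + 1}, (isOpen_lt continuous_snd continuous_const).mem_nhds
          (show y.2 < T + 1 by linarith), fun z hz => ?_⟩
        rw [Pi.sub_apply, pullback_apply, sub_eq_zero]
        refine congrArg ω' (funext fun i => ?_)
        rw [Function.comp_apply, hs0]
        exact Prod.ext rfl (min_eq_left (le_of_lt (hz i)))
    have := Submodule.add_mem _ h1 h2
    rwa [sub_add_sub_cancel] at this
  have hη_out : ∀ y, (y 0).1 ∉ K₁ → η y = 0 := by
    intro y hy
    rw [hη_def, Pi.neg_apply, neg_eq_zero]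
    refine prismPath_eq_zero fun i _ z hz _ => hω' z ⟨0, Or.inl ?_⟩
    rw [hz]
    exact hy
  have hη_bot : ∀ y, (y 0).2 ≤ -T → η y = 0 := by
    intro y hy
    rw [hη_def, Pi.neg_apply, neg_eq_zero]
    refine prismPath_eq_zero fun i _ z hz _ => hω' z ⟨0, Or.inr (Or.inl ?_)⟩
    rw [hz]
    exact (min_le_left _ _).trans hy
  let top : X → X × ℝ := fun x => (x, T + 1)
  have htop : Continuous top := by fun_prop
  -- All the lowering maps forget the height of a point at or above T + 1, hence so does η.
  have hs_top : ∀ i y, T + 1 ≤ y.2 → s i y = s i (top y.1) := by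
    intro i y hy
    have h0 : 0 ≤ i * δ := by positivity
    refine Prod.ext rfl ?_
    change min y.2 (T + 1 - i * δ) = min (T + 1) (T + 1 - i * δ)
    rw [min_eq_right (by linarith), min_eq_right (by linarith)]
  have hη_top : ∀ y, (∀ i, T + 1 ≤ (y i).2) → η y = η (top ∘ Prod.fst ∘ y) := by
    intro y hy
    have h1 : ∀ i l, s i (y l) = s i (top (y l).1) := fun i l => hs_top i _ (hy l)
    have h2 : ∀ i, prismVertex (s i) (s (i + 1)) y =
        prismVertex (s i) (s (i + 1)) (top ∘ Prod.fst ∘ y) := by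
      intro i
      ext1 j
      ext1 l
      simp only [prismVertex, h1, Function.comp_apply]
    simp only [hη_def, Pi.neg_apply, prismPath, prism, h2]
  set ψ : Cochain X p := pullback top p η with hψ_def
  have hdψ : coboundary X p ψ ∈ nullCochains X (p + 1) := by
    have h1 := pullback_mem_nullCochains htop hη
    have h2 : pullback top (p + 1) ω' = 0 := by
      ext x
      rw [pullback_apply, hω' _ ⟨0, Or.inr (Or.inr ?_)⟩]
      · rfl
      · simp [top]
    rw [map_sub, h2, sub_zero] at h1
    exact h1
  have hψ : ψ ∈ cocycles X p := by
    refine mem_cocycles.2 ⟨mem_compactlySupported_of_forall_zero hK₁ fun x hx => ?_, hdψ⟩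
    exact hη_out _ hx
  refine ⟨ψ, hψ, mem_coboundaries_succ.2 ⟨cut X p (pullback Prod.fst p ψ) - η, ?_, ?_⟩⟩
  · refine (hK₁.prod (isCompact_Icc (a := -T) (b := T + 1))).of_isClosed_subset
      (isClosed_support _) fun y hy => ?_
    have hval : ∀ z, (cut X p (pullback Prod.fst p ψ) - η) z =
        heaviside (z 0) * ψ (Prod.fst ∘ z) - η z := fun z => rfl
    by_contra h
    refine notMem_support.2 ?_ hy
    rw [Set.mem_prod, not_and_or, Set.mem_Icc, not_and_or, not_le, not_le] at h
    rcases h with h | h | h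
    · refine ⟨Prod.fst ⁻¹' K₁ᶜ, (hK₁.isClosed.isOpen_compl.preimage continuous_fst).mem_nhds h,
        fun z hz => ?_⟩
      rw [hval, hη_out z (hz 0), show ψ (Prod.fst ∘ z) = 0 from hη_out _ (hz 0)]
      simp
    · refine ⟨{z | z.2 < -T}, (isOpen_lt continuous_snd continuous_const).mem_nhds h,
        fun z hz => ?_⟩
      have hz0 : (z 0).2 < -T := hz 0
      have : heaviside (z 0) = 0 := if_neg (by linarith)
      rw [hval, hη_bot z hz0.le, this]
      simp
    · refine ⟨{z | T + 1 < z.2}, (isOpen_lt continuous_const continuous_snd).mem_nhds h,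
        fun z hz => ?_⟩
      have hz0 : T + 1 < (z 0).2 := hz 0
      have : heaviside (z 0) = 1 := if_pos (by linarith)
      rw [hval, hη_top z fun i => le_of_lt (hz i), this, one_mul]
      exact sub_self _
  · have h1 := cut_mem_nullCochains (pullback_mem_nullCochains continuous_fst hdψ)
    have h2 := Submodule.sub_mem _ (Submodule.sub_mem _ hη hωω') h1
    convert h2 using 1
    rw [map_sub, suspension_eq]
    abel

theorem finrank_cohomology_prod_real_succ (p : ℕ) :
    Module.finrank ℤ (Cohomology (X × ℝ) (p + 1)) = Module.finrank ℤ (Cohomology X p) :=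
  (finrank_cohomology_congr (suspension X p) (fun _ => suspension_mem_cocycles)
    (fun _ hφ => ⟨mem_coboundaries_of_suspension hφ, suspension_mem_coboundaries⟩)
    fun _ => exists_suspension_sub_mem).symm

end Descent

/-! ### The Euler characteristic of a finite set times a Euclidean space -/

section EuclideanSpace

variable {F : Type} [MetricSpace F] [DiscreteTopology F] [Finite F]

theorem finrank_cohomology_prod_euclidean (N : ℕ) : ∀ p,
    Module.finrank ℤ (Cohomology (F × (Fin N → ℝ)) p) = if p = N then Nat.card F else 0 := by
  induction N with
  | zero =>
    intro p
    rw [finrank_cohomology_homeomorph (Homeomorph.prodUnique F (Fin 0 → ℝ)).symm]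
    cases p with
    | zero => simp [finrank_cohomology_discrete_zero]
    | succ p => simp [finrank_cohomology_discrete_succ]
  | succ N ih =>
    intro p
    let e : F × (Fin (N + 1) → ℝ) ≃ₜ (F × (Fin N → ℝ)) × ℝ :=
      ((Homeomorph.refl F).prodCongr ((Fin.appendHomeomorph N 1).symm.trans
        ((Homeomorph.refl _).prodCongr (Homeomorph.funUnique (Fin 1) ℝ)))).trans
        (Homeomorph.prodAssoc _ _ _).symm
    rw [← finrank_cohomology_homeomorph e]
    cases p with
    | zero => simp [finrank_cohomology_prod_real_zero]
    | succ p => simp [finrank_cohomology_prod_real_succ, ih]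

theorem eulerCharCompact_prod_euclidean (N : ℕ) :
    eulerCharCompact (F × (Fin N → ℝ)) = (-1) ^ N * Nat.card F := by
  rw [eulerCharCompact,
    HomologicalComplex.homologyEulerChar_eq_sum_finSet_of_finrankSupport_subset _ {N}]
  · rw [Finset.sum_singleton, finrank_homology_complex, finrank_cohomology_prod_euclidean]
    simp [ComplexShape.χ]
  · rw [GradedObject.finrankSupport_subset_iff]
    intro i hi
    rw [finrank_homology_complex, finrank_cohomology_prod_euclidean, if_neg (by simpa using hi)]

end EuclideanSpace

end AlexanderSpanier

/-! ### Unions of half lines and their Euler characteristics -/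

section SignedSets

/-- The signs `s = ±1` with `0 < τ sᵏ`. -/
def signSet (τ : ℝ) (k : ℕ) : Set ℝ := {s | (s = 1 ∨ s = -1) ∧ 0 < τ * s ^ k}

theorem signSet_finite (τ : ℝ) (k : ℕ) : (signSet τ k).Finite :=
  (Set.toFinite {1, -1}).subset fun _ h => h.1

instance (τ : ℝ) (k : ℕ) : Finite (signSet τ k) := signSet_finite τ k

theorem signSet_even_one {k : ℕ} (hk : Even k) : (signSet 1 k).ncard = 2 := by
  have : signSet 1 k = {1, -1} := by
    ext s
    simp only [signSet, Set.mem_ofPred_eq, Set.mem_insert_iff, Set.mem_singleton_iff]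
    constructor
    · exact fun h => h.1
    · rintro (rfl | rfl) <;> simp [hk.neg_one_pow]
  rw [this, Set.ncard_pair (by norm_num)]

theorem signSet_even_neg_one {k : ℕ} (hk : Even k) : (signSet (-1) k).ncard = 0 := by
  have : signSet (-1) k = ∅ := by
    rw [Set.eq_empty_iff_forall_notMem]
    rintro s ⟨_, h⟩
    have := hk.pow_nonneg s
    linarith
  rw [this, Set.ncard_empty]

theorem signSet_odd {k : ℕ} (hk : Odd k) {τ : ℝ} (hτ : τ = 1 ∨ τ = -1) :
    (signSet τ k).ncard = 1 := by
  have : signSet τ k = {τ} := by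
    ext s
    simp only [signSet, Set.mem_ofPred_eq, Set.mem_singleton_iff]
    rcases hτ with rfl | rfl
    all_goals
      constructor
      · rintro ⟨rfl | rfl, h⟩
        · first | rfl | (norm_num at h)
        · first | rfl | (rw [hk.neg_one_pow] at h; norm_num at h)
      · rintro rfl
        simp [hk.neg_one_pow]
  rw [this, Set.ncard_singleton]

/-- Each of 1 and -1 lies in exactly one of the two sets, whatever the parity of k. -/
theorem signSet_add_signSet_neg {k : ℕ} {τ : ℝ} (hτ : τ = 1 ∨ τ = -1) :
    (signSet τ k).ncard + (signSet (-τ) k).ncard = 2 := by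
  rcases Nat.even_or_odd k with hk | hk
  · rcases hτ with rfl | rfl <;> simp [signSet_even_one hk, signSet_even_neg_one hk]
  · rw [signSet_odd hk hτ, signSet_odd hk (by rcases hτ with rfl | rfl <;> simp)]

theorem ne_zero_of_mul_pow_pos {τ v : ℝ} {k : ℕ} (hk : k ≠ 0) (h : 0 < τ * v ^ k) : v ≠ 0 := by
  rintro rfl
  simp [hk] at h

theorem mul_pow_pos_iff {τ s r : ℝ} {k : ℕ} (hr : 0 < r) :
    0 < τ * (s * r) ^ k ↔ 0 < τ * s ^ k := by
  rw [mul_pow, ← mul_assoc, mul_pos_iff_of_pos_right (pow_pos hr k)]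

theorem div_abs_eq_or {v : ℝ} (hv : v ≠ 0) : v / |v| = 1 ∨ v / |v| = -1 := by
  rcases abs_choice v with h | h <;> rw [h]
  · exact Or.inl (div_self hv)
  · exact Or.inr (by rw [div_neg, div_self hv])

/-- The open set `0 < τ vᵏ` of the line is a union of half lines. -/
noncomputable def halfLinesHomeomorph (τ : ℝ) {k : ℕ} (hk : k ≠ 0) :
    {v : ℝ // 0 < τ * v ^ k} ≃ₜ signSet τ k × ℝ where
  toFun v := (⟨v.1 / |v.1|, div_abs_eq_or (ne_zero_of_mul_pow_pos hk v.2),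
    (mul_pow_pos_iff (abs_pos.2 (ne_zero_of_mul_pow_pos hk v.2))).1 (by
      rw [div_mul_cancel₀ _ (abs_ne_zero.2 (ne_zero_of_mul_pow_pos hk v.2))]
      exact v.2)⟩, Real.log |v.1|)
  invFun p := ⟨p.1.1 * Real.exp p.2, (mul_pow_pos_iff (Real.exp_pos _)).2 p.1.2.2⟩
  left_inv v := by
    have h := ne_zero_of_mul_pow_pos hk v.2
    refine Subtype.ext ?_
    simp only
    rw [Real.exp_log (abs_pos.2 h), div_mul_cancel₀ _ (abs_ne_zero.2 h)]
  right_inv p := by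
    obtain ⟨⟨s, hs, h⟩, r⟩ := p
    have hs1 : |s| = 1 := by rcases hs with rfl | rfl <;> simp
    refine Prod.ext (Subtype.ext ?_) ?_
    · simp only [abs_mul, hs1, one_mul, Real.abs_exp]
      exact mul_div_cancel_right₀ _ (Real.exp_ne_zero _)
    · simp [abs_mul, hs1]
  continuous_toFun := by
    have h : ∀ v : {v : ℝ // 0 < τ * v ^ k}, |v.1| ≠ 0 := fun v =>
      abs_ne_zero.2 (ne_zero_of_mul_pow_pos hk v.2)
    refine Continuous.prodMk (Continuous.subtype_mk ?_ _) ?_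
    · exact continuous_subtype_val.div continuous_subtype_val.abs h
    · exact continuous_subtype_val.abs.log h
  continuous_invFun := by
    refine Continuous.subtype_mk ?_ _
    fun_prop

/-- Each half line is a copy of ℝ. Taking the absolute value drops the sign (-1)^(1 + |I|), so that
the free coefficients of the arcs never have to be counted. -/
theorem natAbs_eulerCharCompact_eq {Z I : Type} [TopologicalSpace Z] [Finite I] {τ : ℝ} {k : ℕ}
    (hk : k ≠ 0) (e : Z ≃ₜ {v : ℝ // 0 < τ * v ^ k} × (I → ℝ)) :
    (eulerCharCompact Z).natAbs = (signSet τ k).ncard := by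
  have e₁ : (I → ℝ) ≃ₜ (Fin (Nat.card I) → ℝ) :=
    Homeomorph.piCongrLeft (Y := fun _ => ℝ) (Finite.equivFin I)
  have e₂ : ℝ × (Fin (Nat.card I) → ℝ) ≃ₜ (Fin (1 + Nat.card I) → ℝ) :=
    ((Homeomorph.funUnique (Fin 1) ℝ).symm.prodCongr (Homeomorph.refl _)).trans
      (Fin.appendHomeomorph 1 _)
  have e₃ : Z ≃ₜ signSet τ k × (Fin (1 + Nat.card I) → ℝ) :=
    (e.trans ((halfLinesHomeomorph τ hk).prodCongr e₁)).trans
      ((Homeomorph.prodAssoc _ _ _).trans ((Homeomorph.refl _).prodCongr e₂))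
  rw [AlexanderSpanier.eulerCharCompact_homeomorph e₃,
    AlexanderSpanier.eulerCharCompact_prod_euclidean, Int.natAbs_mul, Int.natAbs_pow]
  simp [Set.ncard_def, Nat.card_coe_set_eq]

theorem eulerCharCompact_of_isEmpty {Z : Type} [TopologicalSpace Z] [IsEmpty Z] :
    eulerCharCompact Z = 0 := by
  have e : Z ≃ₜ (Empty × (Fin 0 → ℝ)) := Homeomorph.empty
  have e' : (∅ : Set ℝ) × (Fin 0 → ℝ) ≃ₜ (Empty × (Fin 0 → ℝ)) := Homeomorph.empty
  rw [AlexanderSpanier.eulerCharCompact_homeomorph (e.trans e'.symm),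
    AlexanderSpanier.eulerCharCompact_prod_euclidean]
  simp

end SignedSets

/-! ### Orders of vanishing and low coefficients of polynomials -/

section Polynomials

open Polynomial

/-- Factors `X` are split off one at a time: after division by t^N on a punctured neighbourhood, the
cofactor is O(t), so by continuity it vanishes at 0. -/
theorem isBigO_pow_iff_X_pow_dvd (N : ℕ) (P : ℝ[X]) :
    ((fun t : ℝ => P.eval t) =O[𝓝 0] fun t : ℝ => t ^ N) ↔ X ^ N ∣ P := by
  constructor
  · induction N with
    | zero => simp
    | succ N ih =>
      intro h
      have h' : (fun t : ℝ => P.eval t) =O[𝓝 0] fun t : ℝ => t ^ N := by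
        refine h.trans ?_
        have := (isBigO_refl (fun t : ℝ => t ^ N) (𝓝 0)).mul
          ((continuous_id (X := ℝ)).continuousAt (x := 0) |>.isBigO_one ℝ)
        simpa [pow_succ] using this
      obtain ⟨Q, rfl⟩ := ih h'
      rw [pow_succ]
      refine mul_dvd_mul_left _ (X_dvd_iff.2 ?_)
      rw [coeff_zero_eq_eval_zero]
      have h1 : (fun t : ℝ => Q.eval t) =O[𝓝[≠] 0] fun t : ℝ => t := by
        refine ((h.mono nhdsWithin_le_nhds).mul (isBigO_refl (fun t : ℝ => (t ^ N)⁻¹) _)).congr' ?_ ?_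
        · filter_upwards [self_mem_nhdsWithin] with t ht
          have : t ^ N ≠ 0 := pow_ne_zero _ ht
          simp only [eval_mul, eval_pow, eval_X]
          field_simp
        · filter_upwards [self_mem_nhdsWithin] with t ht
          have : t ^ N ≠ 0 := pow_ne_zero _ ht
          rw [pow_succ]
          field_simp
      have h2 : Filter.Tendsto (fun t : ℝ => Q.eval t) (𝓝[≠] 0) (𝓝 0) :=
        h1.trans_tendsto (Filter.tendsto_id.mono_left nhdsWithin_le_nhds)
      have h3 : Filter.Tendsto (fun t : ℝ => Q.eval t) (𝓝[≠] 0) (𝓝 (Q.eval 0)) :=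
        (Q.continuous.tendsto 0).mono_left nhdsWithin_le_nhds
      exact tendsto_nhds_unique h3 h2
  · rintro ⟨Q, rfl⟩
    have := (isBigO_refl (fun t : ℝ => t ^ N) (𝓝 0)).mul
      (Q.continuous.continuousAt (x := 0) |>.isBigO_one ℝ)
    simpa using this

theorem X_pow_succ_dvd_sub_iff {P : ℝ[X]} {n : ℕ} {c : ℝ} :
    X ^ (n + 1) ∣ P - C c * X ^ n ↔ X ^ n ∣ P ∧ P.coeff n = c := by
  simp only [X_pow_dvd_iff, coeff_sub, coeff_C_mul, coeff_X_pow]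
  constructor
  · intro h
    refine ⟨fun d hd => ?_, ?_⟩
    · simpa [hd.ne] using h d (by omega)
    · have := h n (by omega)
      simp only [if_true, mul_one] at this
      linarith
  · rintro ⟨h, h'⟩ d hd
    rcases Nat.lt_succ_iff_lt_or_eq.1 hd with hd | rfl
    · simp [hd.ne, h d hd]
    · simp [h']

/-- In terms of orders at 0: m · ord P ≥ n > m q forces ord P > q. -/
theorem X_pow_dvd_of_dvd_pow {P : ℝ[X]} {m n q : ℕ} (h : X ^ n ∣ P ^ m) (hq : m * q < n) :
    X ^ (q + 1) ∣ P := by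
  have step : ∀ j, j ≤ q + 1 → X ^ j ∣ P := by
    intro j
    induction j with
    | zero => simp
    | succ j ih =>
      intro hj
      obtain ⟨Q, rfl⟩ := ih (by omega)
      rw [pow_succ]
      refine mul_dvd_mul_left _ (prime_X.dvd_of_dvd_pow (n := m) ?_)
      have hlt : j * m + 1 ≤ n := by
        have : m * j ≤ m * q := Nat.mul_le_mul_left _ (by omega)
        rw [mul_comm j m]
        omega
      have := (pow_dvd_pow (X : ℝ[X]) hlt).trans h
      rw [mul_pow, ← pow_mul, pow_succ] at this
      exact (mul_dvd_mul_iff_left (pow_ne_zero _ X_ne_zero)).1 this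
  exact step _ le_rfl

/-- The polynomial `b₁ t + ⋯ + bₙ tⁿ`. -/
noncomputable def arcPoly {n : ℕ} (b : Fin n → ℝ) : ℝ[X] := ∑ j, C (b j) * X ^ ((j : ℕ) + 1)

theorem arcPoly_coeff {n : ℕ} (b : Fin n → ℝ) (j : Fin n) :
    (arcPoly b).coeff ((j : ℕ) + 1) = b j := by
  simp [arcPoly, coeff_X_pow, Fin.val_inj]

theorem arcPoly_coeff_zero {n : ℕ} (b : Fin n → ℝ) : (arcPoly b).coeff 0 = 0 := by
  simp [arcPoly, coeff_X_pow]

theorem X_dvd_arcPoly {n : ℕ} (b : Fin n → ℝ) : X ∣ arcPoly b :=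
  X_dvd_iff.2 (arcPoly_coeff_zero b)

/-- The entry with index i is the coefficient of degree i + 1, whence the shift in the exponent. -/
theorem X_pow_dvd_arcPoly_iff {n : ℕ} (b : Fin n → ℝ) {r : ℕ} (hr : r ≤ n) :
    X ^ (r + 1) ∣ arcPoly b ↔ ∀ i : Fin n, (i : ℕ) < r → b i = 0 := by
  rw [X_pow_dvd_iff]
  constructor
  · intro h i hi
    rw [← arcPoly_coeff b i]
    exact h _ (by omega)
  · intro h d hd
    cases d with
    | zero => exact arcPoly_coeff_zero b
    | succ d =>
      rw [arcPoly_coeff b ⟨d, by omega⟩]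
      exact h _ (by simp; omega)

theorem coeff_pow_of_X_mul {Q : ℝ[X]} (k : ℕ) : ((X * Q) ^ k).coeff k = Q.coeff 0 ^ k := by
  rw [mul_pow, coeff_X_pow_mul', if_pos le_rfl, Nat.sub_self, coeff_zero_eq_eval_zero, eval_pow,
    ← coeff_zero_eq_eval_zero]

/-- The coefficient of degree 1 is the derivative at 0. -/
theorem coeff_one_pow (Q : ℝ[X]) (k : ℕ) :
    (Q ^ k).coeff 1 = k * Q.coeff 0 ^ (k - 1) * Q.coeff 1 := by
  have h : ∀ P : ℝ[X], P.coeff 1 = (derivative P).eval 0 := fun P => by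
    rw [← coeff_zero_eq_eval_zero, coeff_derivative]
    simp
  rw [h, h, derivative_pow, coeff_zero_eq_eval_zero]
  simp

end Polynomials

/-! ### Equations and inequalities for the arc sets -/

section Arcs

open Polynomial

variable {n : ℕ} (m k : ℕ) (ε : ℤˣ)

/-- The polynomial `x(t)ᵐ + ε y(t)ᵏ` for a truncated arc `(x(t), y(t))` of the plane. -/
noncomputable def starPoly (a : Fin n → Fin 1 ⊕ Fin 1 → ℝ) : ℝ[X] :=
  arcPoly (fun i => a i (Sum.inl 0)) ^ m + C ((ε : ℤ) : ℝ) * arcPoly (fun i => a i (Sum.inr 0)) ^ k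

theorem starSum_truncatedArc (a : Fin n → Fin 1 ⊕ Fin 1 → ℝ) (t : ℝ) :
    starSum (signedPower 1 m) (signedPower ε k) (truncatedArc a t) = (starPoly m k ε a).eval t := by
  have h : ∀ s, truncatedArc a t s = (arcPoly fun i => a i s).eval t := fun s => by
    simp only [truncatedArc, arcPoly, Finset.sum_apply, Pi.smul_apply, smul_eq_mul,
      eval_finsetSum, eval_mul, eval_C, eval_pow, eval_X]
    exact Finset.sum_congr rfl fun j _ => mul_comm _ _
  simp [starSum, signedPower, starPoly, h]

theorem hasTerm_iff (a : Fin n → Fin 1 ⊕ Fin 1 → ℝ) (c : ℝ) :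
    HasTerm (starSum (signedPower 1 m) (signedPower ε k)) a c ↔
      X ^ n ∣ starPoly m k ε a ∧ (starPoly m k ε a).coeff n = c := by
  rw [← X_pow_succ_dvd_sub_iff, ← isBigO_pow_iff_X_pow_dvd, HasTerm]
  simp [starSum_truncatedArc]

/-- The truncated arcs along which `xᵐ + ε yᵏ` is `c tⁿ + ⋯` with `c` of the sign of `σ`. -/
def signedArcs (n m k : ℕ) (ε : ℤˣ) (σ : ℝ) : Set (Fin n → Fin 1 ⊕ Fin 1 → ℝ) :=
  {a | X ^ n ∣ starPoly m k ε a ∧ 0 < σ * (starPoly m k ε a).coeff n}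

theorem arcsPos_eq (n : ℕ) :
    arcsPos (starSum (signedPower 1 m) (signedPower ε k)) n = signedArcs n m k ε 1 := by
  ext a
  simp only [arcsPos, signedArcs, hasTerm_iff, Set.mem_ofPred_eq, one_mul]
  constructor
  · rintro ⟨c, hc, h, rfl⟩
    exact ⟨h, hc⟩
  · rintro ⟨h, hc⟩
    exact ⟨_, hc, h, rfl⟩

theorem arcsNeg_eq (n : ℕ) :
    arcsNeg (starSum (signedPower 1 m) (signedPower ε k)) n = signedArcs n m k ε (-1) := by
  ext a
  simp only [arcsNeg, signedArcs, hasTerm_iff, Set.mem_ofPred_eq, neg_mul, one_mul, Left.neg_pos_iff]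
  constructor
  · rintro ⟨c, hc, h, rfl⟩
    exact ⟨h, hc⟩
  · rintro ⟨h, hc⟩
    exact ⟨_, hc, h, rfl⟩

variable {m k ε}

/-- The term in y has order at least k > n, while the order of xᵐ is a multiple of m and so is not
n. Divisibility by t^n therefore forces the coefficient of t^n to vanish. -/
theorem signedArcs_eq_empty {σ : ℝ} (hm : 0 < m) (hnk : n < k) (hmn : ¬ m ∣ n) :
    signedArcs n m k ε σ = ∅ := by
  rw [Set.eq_empty_iff_forall_notMem]
  rintro a ⟨h, hc⟩
  have hy : X ^ (n + 1) ∣ C ((ε : ℤ) : ℝ) * arcPoly (fun i => a i (Sum.inr 0)) ^ k :=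
    ((pow_dvd_pow X hnk).trans (pow_dvd_pow_of_dvd (X_dvd_arcPoly _) k)).mul_left _
  have hx : X ^ n ∣ arcPoly (fun i => a i (Sum.inl 0)) ^ m :=
    (dvd_add_left ((pow_dvd_pow X n.le_succ).trans hy)).1 h
  have hlt : m * (n / m) < n :=
    lt_of_le_of_ne (Nat.mul_div_le n m) fun h => hmn ⟨_, h.symm⟩
  have hx' : X ^ (n + 1) ∣ arcPoly (fun i => a i (Sum.inl 0)) ^ m := by
    have h1 := pow_dvd_pow_of_dvd (X_pow_dvd_of_dvd_pow hx hlt) m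
    rw [← pow_mul] at h1
    refine (pow_dvd_pow X ?_).trans h1
    have := Nat.lt_mul_div_succ n hm
    rw [mul_comm]
    omega
  have h0 := X_pow_dvd_iff.1 (dvd_add hx' hy) n n.lt_succ_self
  rw [starPoly, h0, mul_zero] at hc
  exact lt_irrefl _ hc

/-- Since m ∤ k, xᵐ has order at least k only if its order exceeds k, that is, if x has order at
least ⌊k/m⌋ + 1. The coefficient of t^k is then ε y₁ᵏ, with y₁ stored at index 0. -/
theorem mem_signedArcs_self_iff {σ : ℝ} (hm : 0 < m) (hk : 0 < k) (hmk : ¬ m ∣ k)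
    (a : Fin k → Fin 1 ⊕ Fin 1 → ℝ) :
    a ∈ signedArcs k m k ε σ ↔ (∀ i : Fin k, (i : ℕ) < k / m → a i (Sum.inl 0) = 0) ∧
      0 < σ * ε * a ⟨0, hk⟩ (Sum.inr 0) ^ k := by
  have hlt : m * (k / m) < k :=
    lt_of_le_of_ne (Nat.mul_div_le k m) fun h => hmk ⟨_, h.symm⟩
  obtain ⟨Q, hQ⟩ := X_dvd_arcPoly fun i => a i (Sum.inr 0)
  have hQ0 : Q.coeff 0 = a ⟨0, hk⟩ (Sum.inr 0) := by
    have := arcPoly_coeff (fun i => a i (Sum.inr 0)) ⟨0, hk⟩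
    rw [hQ] at this
    simpa using this
  have hy : X ^ k ∣ C ((ε : ℤ) : ℝ) * arcPoly (fun i => a i (Sum.inr 0)) ^ k :=
    (pow_dvd_pow_of_dvd (X_dvd_arcPoly _) k).mul_left _
  have hx : X ^ (k / m + 1) ∣ arcPoly (fun i => a i (Sum.inl 0)) →
      X ^ (k + 1) ∣ arcPoly (fun i => a i (Sum.inl 0)) ^ m := by
    intro h
    have h1 := pow_dvd_pow_of_dvd h m
    rw [← pow_mul] at h1
    refine (pow_dvd_pow X ?_).trans h1
    have := Nat.lt_mul_div_succ k hm
    rw [mul_comm]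
    omega
  have hdvd : X ^ k ∣ starPoly m k ε a ↔ X ^ (k / m + 1) ∣ arcPoly (fun i => a i (Sum.inl 0)) := by
    rw [starPoly, dvd_add_left hy]
    exact ⟨fun h => X_pow_dvd_of_dvd_pow h hlt, fun h => (pow_dvd_pow X k.le_succ).trans (hx h)⟩
  rw [← X_pow_dvd_arcPoly_iff _ (Nat.div_le_self k m), signedArcs, Set.mem_ofPred_eq, hdvd]
  refine and_congr_right fun h => ?_
  rw [starPoly, coeff_add, X_pow_dvd_iff.1 (hx h) k k.lt_succ_self, coeff_C_mul, hQ,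
    coeff_pow_of_X_mul, hQ0, zero_add, mul_assoc]

/-- Order above k = mq forces x to have order at least q and the coefficients of t^k to cancel.
Writing x = t^q u and y = t v, one factors out t^k; the constant term of uᵐ + ε vᵏ must vanish, and
its linear term is the coefficient in question. Index q - 1 holds the coefficient of x at t^q. -/
theorem mem_signedArcs_succ_iff {σ : ℝ} {q : ℕ} (hm : 1 < m) (hodd : Odd m) (hq : 0 < q)
    (hk : k = m * q) (h0 : 0 < k + 1) (h1 : 1 < k + 1) (hq1 : q - 1 < k + 1) (hq2 : q < k + 1)
    (a : Fin (k + 1) → Fin 1 ⊕ Fin 1 → ℝ) :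
    a ∈ signedArcs (k + 1) m k ε σ ↔ (∀ i : Fin (k + 1), (i : ℕ) < q - 1 → a i (Sum.inl 0) = 0) ∧
      a ⟨q - 1, hq1⟩ (Sum.inl 0) = - (ε * a ⟨0, h0⟩ (Sum.inr 0) ^ q) ∧
      0 < σ * (m * a ⟨q - 1, hq1⟩ (Sum.inl 0) ^ (m - 1) * a ⟨q, hq2⟩ (Sum.inl 0) +
        ε * (k * a ⟨0, h0⟩ (Sum.inr 0) ^ (k - 1) * a ⟨1, h1⟩ (Sum.inr 0))) := by
  obtain ⟨v, hv⟩ := X_dvd_arcPoly fun i => a i (Sum.inr 0)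
  have hv0 : v.coeff 0 = a ⟨0, h0⟩ (Sum.inr 0) := by
    have := arcPoly_coeff (fun i => a i (Sum.inr 0)) ⟨0, h0⟩
    rw [hv] at this
    simpa using this
  have hv1 : v.coeff 1 = a ⟨1, h1⟩ (Sum.inr 0) := by
    have := arcPoly_coeff (fun i => a i (Sum.inr 0)) ⟨1, h1⟩
    rw [hv] at this
    simpa [coeff_X_mul] using this
  have hy : X ^ k ∣ C ((ε : ℤ) : ℝ) * arcPoly (fun i => a i (Sum.inr 0)) ^ k :=
    (pow_dvd_pow_of_dvd (X_dvd_arcPoly _) k).mul_left _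
  have hε : ((ε : ℤ) : ℝ) ^ m = ((ε : ℤ) : ℝ) := by
    rcases Int.units_eq_one_or ε with rfl | rfl <;> simp [hodd.neg_one_pow]
  -- As m is odd, taking m-th powers is injective on ℝ and ε = εᵐ, so the cancellation has exactly
  -- one real solution.
  have hroot : ∀ x y : ℝ, x ^ m + ε * y ^ k = 0 ↔ x = - (ε * y ^ q) := by
    intro x y
    rw [← hodd.strictMono_pow.injective.eq_iff (a := x), hodd.neg_pow, mul_pow, hε, ← pow_mul,
      mul_comm q m, ← hk, eq_neg_iff_add_eq_zero]
  rw [← X_pow_dvd_arcPoly_iff _ (by omega), Nat.sub_add_cancel hq]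
  have hdvd : X ^ (k + 1) ∣ starPoly m k ε a → X ^ q ∣ arcPoly (fun i => a i (Sum.inl 0)) := by
    intro h
    have h' := (dvd_add_left hy).1 ((pow_dvd_pow X k.le_succ).trans h)
    have hlt : m * (q - 1) < k := by
      rw [hk]
      exact Nat.mul_lt_mul_of_pos_left (by omega) (by omega)
    have := X_pow_dvd_of_dvd_pow h' hlt
    rwa [Nat.sub_add_cancel hq] at this
  have key : X ^ q ∣ arcPoly (fun i => a i (Sum.inl 0)) →
      (a ∈ signedArcs (k + 1) m k ε σ ↔
      a ⟨q - 1, hq1⟩ (Sum.inl 0) = - (ε * a ⟨0, h0⟩ (Sum.inr 0) ^ q) ∧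
      0 < σ * (m * a ⟨q - 1, hq1⟩ (Sum.inl 0) ^ (m - 1) * a ⟨q, hq2⟩ (Sum.inl 0) +
        ε * (k * a ⟨0, h0⟩ (Sum.inr 0) ^ (k - 1) * a ⟨1, h1⟩ (Sum.inr 0)))) := by
    rintro ⟨u, hu⟩
    have hu0 : u.coeff 0 = a ⟨q - 1, hq1⟩ (Sum.inl 0) := by
      have := arcPoly_coeff (fun i => a i (Sum.inl 0)) ⟨q - 1, hq1⟩
      rw [hu] at this
      simp only [Nat.sub_add_cancel hq] at this
      rw [← this, coeff_X_pow_mul', if_pos le_rfl, Nat.sub_self]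
    have hu1 : u.coeff 1 = a ⟨q, hq2⟩ (Sum.inl 0) := by
      have := arcPoly_coeff (fun i => a i (Sum.inl 0)) ⟨q, hq2⟩
      rw [hu] at this
      rw [← this, coeff_X_pow_mul', if_pos q.le_succ]
      simp
    have hP : starPoly m k ε a = X ^ k * (u ^ m + C ((ε : ℤ) : ℝ) * v ^ k) := by
      rw [starPoly, hu, hv, mul_pow, mul_pow, ← pow_mul, mul_comm q m, ← hk]
      ring
    have hc0 : ∀ (Q : ℝ[X]) (j : ℕ), (Q ^ j).coeff 0 = Q.coeff 0 ^ j := fun Q j => by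
      simp [coeff_zero_eq_eval_zero]
    rw [signedArcs, Set.mem_ofPred_eq, hP, pow_succ,
      mul_dvd_mul_iff_left (pow_ne_zero _ X_ne_zero), X_dvd_iff, coeff_X_pow_mul',
      if_pos k.le_succ, Nat.add_sub_cancel_left, coeff_add, coeff_add, coeff_C_mul, coeff_C_mul,
      hc0, hc0, coeff_one_pow, coeff_one_pow, hu0, hu1, hv0, hv1, hroot]
  exact ⟨fun h => ⟨hdvd h.1, (key (hdvd h.1)).1 h⟩, fun h => (key h.1).2 h.2⟩

end Arcs

/-! ### Homeomorphisms of the arc sets with half lines times Euclidean spaces -/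

section ArcSpaces

variable {m k : ℕ} {ε : ℤˣ} {σ : ℝ}

theorem units_cast_eq (ε : ℤˣ) : ((ε : ℤ) : ℝ) = 1 ∨ ((ε : ℤ) : ℝ) = -1 := by
  rcases Int.units_eq_one_or ε with rfl | rfl <;> simp

theorem continuous_coordinate {I J : Type} (S : Set (I → J → ℝ)) (i : I) (j : J) :
    Continuous fun a : S => a.1 i j :=
  (continuous_apply_apply i j).comp continuous_subtype_val

/-- Coordinates on the arcs of leading order `k` along which `εyᵏ` dominates. -/
noncomputable def signedArcsSelfHomeomorph (hm : 0 < m) (hk : 0 < k) (hmk : ¬ m ∣ k) :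
    signedArcs k m k ε σ ≃ₜ {v : ℝ // 0 < σ * ε * v ^ k} ×
      ({i : Fin k // k / m ≤ i} ⊕ {i : Fin k // 0 < (i : ℕ)} → ℝ) where
  toFun a := (⟨a.1 ⟨0, hk⟩ (Sum.inr 0), ((mem_signedArcs_self_iff hm hk hmk _).1 a.2).2⟩,
    Sum.elim (fun i => a.1 i (Sum.inl 0)) (fun i => a.1 i (Sum.inr 0)))
  invFun p := ⟨fun i => Sum.elim
      (fun _ => if h : k / m ≤ i then p.2 (Sum.inl ⟨i, h⟩) else 0)
      (fun _ => if h : 0 < (i : ℕ) then p.2 (Sum.inr ⟨i, h⟩) else p.1.1),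
    (mem_signedArcs_self_iff hm hk hmk _).2 ⟨fun i hi => dif_neg (not_le.2 hi), p.1.2⟩⟩
  left_inv a := by
    obtain ⟨a, ha⟩ := a
    refine Subtype.ext (funext fun i => funext fun s => ?_)
    rcases s with s | s <;> rw [Subsingleton.elim s 0]
    · by_cases h : k / m ≤ i
      · simp [h]
      · simp [h, ((mem_signedArcs_self_iff hm hk hmk _).1 ha).1 i (not_le.1 h)]
    · by_cases h : 0 < (i : ℕ)
      · simp [h]
      · have hi : i = ⟨0, hk⟩ := Fin.ext (by simpa using h)
        simp [hi]
  right_inv p := by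
    obtain ⟨v, b⟩ := p
    refine Prod.ext (Subtype.ext (by simp)) (funext fun j => ?_)
    rcases j with ⟨i, hi⟩ | ⟨i, hi⟩ <;> simp [hi]
  continuous_toFun := by
    refine Continuous.prodMk (Continuous.subtype_mk (continuous_coordinate _ _ _) _)
      (continuous_pi fun j => ?_)
    rcases j with i | i
    · exact continuous_coordinate _ _ _
    · exact continuous_coordinate _ _ _
  continuous_invFun := by
    refine Continuous.subtype_mk (continuous_pi fun i => continuous_pi fun s => ?_) _
    rcases s with s | s <;> simp only [Sum.elim_inl, Sum.elim_inr] <;> split_ifs <;> fun_prop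

/-- If y₁ = 0, then the coefficient of x at t^q is 0 too, and both terms of the coefficient of
t^(k+1) vanish because m > 1 and k > 1. -/
theorem mem_signedArcs_succ_ne_zero {q : ℕ} (hm : 1 < m) (hodd : Odd m) (hq : 0 < q)
    (hk : k = m * q) (h0 : 0 < k + 1) {a : Fin (k + 1) → Fin 1 ⊕ Fin 1 → ℝ}
    (ha : a ∈ signedArcs (k + 1) m k ε σ) : a ⟨0, h0⟩ (Sum.inr 0) ≠ 0 := by
  have hmq : m ≤ k := hk ▸ Nat.le_mul_of_pos_right m hq
  have hqm : q ≤ k := hk ▸ Nat.le_mul_of_pos_left q (by omega)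
  obtain ⟨-, h2, h3⟩ := (mem_signedArcs_succ_iff hm hodd hq hk h0 (by omega) (by omega)
    (by omega) a).1 ha
  intro h
  rw [h2, h, zero_pow hq.ne', mul_zero, neg_zero, zero_pow (by omega), zero_pow (by omega)] at h3
  simp at h3

/-- The arc with `y`-coordinates `v` and `b`, for which `xᵐ + ε yᵏ` vanishes to order `k + 1` and
has the next coefficient `c`. -/
noncomputable def succArc (m k q : ℕ) (ε : ℤˣ) (h1 : 1 < k + 1) (v c : ℝ)
    (b : {i : Fin (k + 1) // q < i} ⊕ {i : Fin (k + 1) // 0 < (i : ℕ)} → ℝ) :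
    Fin (k + 1) → Fin 1 ⊕ Fin 1 → ℝ :=
  fun i => Sum.elim
    (fun _ => if h : q < i then b (Sum.inl ⟨i, h⟩) else if (i : ℕ) = q then
      (c - ε * (k * v ^ (k - 1) * b (Sum.inr ⟨⟨1, h1⟩, Nat.one_pos⟩))) /
        (m * (-(ε * v ^ q)) ^ (m - 1))
      else if (i : ℕ) + 1 = q then -(ε * v ^ q) else 0)
    (fun _ => if h : 0 < (i : ℕ) then b (Sum.inr ⟨i, h⟩) else v)

/-- For v ≠ 0 the coefficient of t^(k+1) depends on the coefficient of x at t^(q+1) through an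
affine function of nonzero slope, so any value c can be prescribed. -/
theorem succArc_mem {q : ℕ} (hm : 1 < m) (hodd : Odd m) (hq : 0 < q) (hk : k = m * q)
    (h1 : 1 < k + 1) {v c : ℝ} (hv : v ≠ 0) (hc : 0 < σ * c)
    (b : {i : Fin (k + 1) // q < i} ⊕ {i : Fin (k + 1) // 0 < (i : ℕ)} → ℝ) :
    succArc m k q ε h1 v c b ∈ signedArcs (k + 1) m k ε σ := by
  have hqk : q ≤ k := hk ▸ Nat.le_mul_of_pos_left q (by omega)
  have hε : ((ε : ℤ) : ℝ) ≠ 0 := by rcases units_cast_eq ε with h | h <;> rw [h] <;> norm_num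
  have hx : (m : ℝ) * (-(ε * v ^ q)) ^ (m - 1) ≠ 0 :=
    mul_ne_zero (by exact_mod_cast (by omega : m ≠ 0))
      (pow_ne_zero _ (neg_ne_zero.2 (mul_ne_zero hε (pow_ne_zero _ hv))))
  have e1 : succArc m k q ε h1 v c b ⟨q - 1, by omega⟩ (Sum.inl 0) = -(ε * v ^ q) := by
    simp only [succArc, Sum.elim_inl]
    rw [dif_neg (by omega), if_neg (by omega), if_pos (by omega)]
  have e2 : succArc m k q ε h1 v c b ⟨q, by omega⟩ (Sum.inl 0) =
      (c - ε * (k * v ^ (k - 1) * b (Sum.inr ⟨⟨1, h1⟩, Nat.one_pos⟩))) /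
        (m * (-(ε * v ^ q)) ^ (m - 1)) := by
    simp only [succArc, Sum.elim_inl]
    rw [dif_neg (by omega), if_pos trivial]
  have e3 : succArc m k q ε h1 v c b ⟨0, by omega⟩ (Sum.inr 0) = v := by simp [succArc]
  have e4 : succArc m k q ε h1 v c b ⟨1, h1⟩ (Sum.inr 0) =
    b (Sum.inr ⟨⟨1, h1⟩, Nat.one_pos⟩) := by simp [succArc]
  refine (mem_signedArcs_succ_iff hm hodd hq hk (by omega) h1 (by omega) (by omega) _).2
    ⟨fun i hi => ?_, ?_, ?_⟩
  · simp only [succArc, Sum.elim_inl]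
    rw [dif_neg (by omega), if_neg (by omega), if_neg (by omega)]
  · rw [e1, e3]
  · rw [e1, e2, e3, e4, mul_div_cancel₀ _ hx, sub_add_cancel]
    exact hc

/-- The coefficient of `t ^ (k + 1)` in `xᵐ + ε yᵏ` on the arcs for which it is the first. -/
noncomputable def succCoeff (m k q : ℕ) (ε : ℤˣ) (h1 : 1 < k + 1) (hqk : q ≤ k)
    (a : Fin (k + 1) → Fin 1 ⊕ Fin 1 → ℝ) : ℝ :=
  m * a ⟨q - 1, by omega⟩ (Sum.inl 0) ^ (m - 1) * a ⟨q, by omega⟩ (Sum.inl 0) +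
    ε * (k * a ⟨0, by omega⟩ (Sum.inr 0) ^ (k - 1) * a ⟨1, h1⟩ (Sum.inr 0))

theorem succArc_succCoeff {q : ℕ} (hm : 1 < m) (hodd : Odd m) (hq : 0 < q) (hk : k = m * q)
    (h1 : 1 < k + 1) (hqk : q ≤ k) {a : Fin (k + 1) → Fin 1 ⊕ Fin 1 → ℝ}
    (ha : a ∈ signedArcs (k + 1) m k ε σ) :
    succArc m k q ε h1 (a ⟨0, by omega⟩ (Sum.inr 0)) (succCoeff m k q ε h1 hqk a)
      (Sum.elim (fun i => a i (Sum.inl 0)) (fun i => a i (Sum.inr 0))) = a := by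
  obtain ⟨hz, hx, -⟩ := (mem_signedArcs_succ_iff hm hodd hq hk (by omega) h1 (by omega)
    (by omega) a).1 ha
  have hv := mem_signedArcs_succ_ne_zero hm hodd hq hk (by omega) ha
  have hε : ((ε : ℤ) : ℝ) ≠ 0 := by rcases units_cast_eq ε with h | h <;> rw [h] <;> norm_num
  have hx0 : (m : ℝ) * a ⟨q - 1, by omega⟩ (Sum.inl 0) ^ (m - 1) ≠ 0 := by
    rw [hx]
    exact mul_ne_zero (by exact_mod_cast (by omega : m ≠ 0))
      (pow_ne_zero _ (neg_ne_zero.2 (mul_ne_zero hε (pow_ne_zero _ hv))))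
  refine funext fun i => funext fun s => ?_
  rcases s with s | s <;> rw [Subsingleton.elim s 0]
  · simp only [succArc, Sum.elim_inl, Sum.elim_inr]
    rw [← hx]
    split_ifs with c1 c2 c3
    · rfl
    · rw [succCoeff, add_sub_cancel_right, mul_div_cancel_left₀ _ hx0]
      exact congrArg (fun j => a j (Sum.inl 0)) (Fin.ext c2.symm)
    · exact congrArg (fun j => a j (Sum.inl 0)) (Fin.ext (by simp; omega))
    · exact (hz i (by omega)).symm
  · simp only [succArc, Sum.elim_inr]
    split_ifs with c1
    · rfl
    · exact congrArg (fun j => a j (Sum.inr 0)) (Fin.ext (by simp; omega))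

theorem succCoeff_succArc {q : ℕ} (hm : 1 < m) (hq : 0 < q)
    (h1 : 1 < k + 1) (hqk : q ≤ k) {v c : ℝ} (hv : v ≠ 0)
    (b : {i : Fin (k + 1) // q < i} ⊕ {i : Fin (k + 1) // 0 < (i : ℕ)} → ℝ) :
    succCoeff m k q ε h1 hqk (succArc m k q ε h1 v c b) = c := by
  have hε : ((ε : ℤ) : ℝ) ≠ 0 := by rcases units_cast_eq ε with h | h <;> rw [h] <;> norm_num
  have hx : (m : ℝ) * (-(ε * v ^ q)) ^ (m - 1) ≠ 0 :=
    mul_ne_zero (by exact_mod_cast (by omega : m ≠ 0))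
      (pow_ne_zero _ (neg_ne_zero.2 (mul_ne_zero hε (pow_ne_zero _ hv))))
  have e0 : ¬ q < q - 1 := by omega
  have e1 : ¬ q - 1 = q := by omega
  have e2 : q - 1 + 1 = q := by omega
  simp only [succCoeff, succArc, Sum.elim_inl, Sum.elim_inr, lt_irrefl, dif_neg, not_false_eq_true,
    if_true, e0, e1, e2, if_false, Nat.one_pos, dif_pos]
  rw [mul_div_cancel₀ _ hx, sub_add_cancel]

theorem signed_mul_pos (hσ : σ = 1 ∨ σ = -1) (r : ℝ) : 0 < σ * (σ * Real.exp r) := by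
  have := Real.exp_pos r
  rcases hσ with rfl | rfl <;> simpa

theorem ne_zero_of_one_mul_sq_pos {v : ℝ} (h : 0 < 1 * v ^ 2) : v ≠ 0 :=
  ne_zero_of_mul_pow_pos two_ne_zero h

/-- Coordinates on the arcs along which the terms of order `m q = k` cancel. -/
noncomputable def signedArcsSuccHomeomorph {q : ℕ} (hm : 1 < m) (hodd : Odd m) (hq : 0 < q)
    (hk : k = m * q) (h1 : 1 < k + 1) (hqk : q ≤ k) (hσ : σ = 1 ∨ σ = -1) :
    signedArcs (k + 1) m k ε σ ≃ₜ {v : ℝ // 0 < 1 * v ^ 2} ×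
      (({i : Fin (k + 1) // q < i} ⊕ {i : Fin (k + 1) // 0 < (i : ℕ)}) ⊕ Unit → ℝ) where
  -- The condition `0 < 1 * v ^ 2` is v ≠ 0 in the shape that `natAbs_eulerCharCompact_eq` takes.
  -- The coefficient c of t^(k+1), restricted to one sign, becomes a free real coordinate through
  -- the logarithm of σc.
  toFun a := (⟨a.1 ⟨0, by omega⟩ (Sum.inr 0), by
      rw [one_mul]
      exact sq_pos_of_ne_zero (mem_signedArcs_succ_ne_zero hm hodd hq hk _ a.2)⟩,
    Sum.elim (Sum.elim (fun i => a.1 i (Sum.inl 0)) (fun i => a.1 i (Sum.inr 0)))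
      fun _ => Real.log (σ * succCoeff m k q ε h1 hqk a.1))
  invFun p := ⟨succArc m k q ε h1 p.1.1 (σ * Real.exp (p.2 (Sum.inr ()))) (p.2 ∘ Sum.inl),
    succArc_mem hm hodd hq hk h1 (ne_zero_of_one_mul_sq_pos p.1.2) (signed_mul_pos hσ _) _⟩
  left_inv a := by
    have hpos : 0 < σ * succCoeff m k q ε h1 hqk a.1 :=
      ((mem_signedArcs_succ_iff hm hodd hq hk (by omega) h1 (by omega) (by omega) a.1).1 a.2).2.2
    have hc : σ * Real.exp (Real.log (σ * succCoeff m k q ε h1 hqk a.1)) =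
        succCoeff m k q ε h1 hqk a.1 := by
      rw [Real.exp_log hpos]
      rcases hσ with rfl | rfl <;> ring
    refine Subtype.ext ?_
    simp only [Sum.elim_inr, Sum.elim_comp_inl, hc]
    exact succArc_succCoeff hm hodd hq hk h1 hqk a.2
  right_inv p := by
    obtain ⟨⟨v, hv⟩, b⟩ := p
    refine Prod.ext (Subtype.ext (by simp [succArc])) (funext fun j => ?_)
    rcases j with (⟨i, hi⟩ | ⟨i, hi⟩) | j
    · simp [succArc, hi]
    · simp only [succArc, Sum.elim_inl, Sum.elim_inr, Function.comp_apply]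
      exact dif_pos hi
    · simp only [Sum.elim_inr]
      rw [succCoeff_succArc hm hq h1 hqk (ne_zero_of_one_mul_sq_pos hv), ← mul_assoc]
      rcases hσ with rfl | rfl <;> simp
  continuous_toFun := by
    refine Continuous.prodMk (Continuous.subtype_mk (continuous_coordinate _ _ _) _)
      (continuous_pi fun j => ?_)
    rcases j with (i | i) | j
    · exact continuous_coordinate _ _ _
    · exact continuous_coordinate _ _ _
    · refine Continuous.log (continuous_const.mul ?_) fun a => ne_of_gt
        ((mem_signedArcs_succ_iff hm hodd hq hk (by omega) h1 (by omega) (by omega) a.1).1 a.2).2.2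
      have h := fun i j => continuous_coordinate (signedArcs (k + 1) m k ε σ) i j
      exact ((continuous_const.mul ((h _ _).pow _)).mul (h _ _)).add
        (continuous_const.mul ((continuous_const.mul ((h _ _).pow _)).mul (h _ _)))
  continuous_invFun := by
    refine Continuous.subtype_mk (continuous_pi fun i => continuous_pi fun s => ?_) _
    rcases s with s | s <;> simp only [succArc, Sum.elim_inl, Sum.elim_inr, Function.comp_apply]
    · split_ifs
      · fun_prop
      · have hε : ((ε : ℤ) : ℝ) ≠ 0 := by
          rcases units_cast_eq ε with h | h <;> rw [h] <;> norm_num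
        refine Continuous.div (by fun_prop) (by fun_prop) fun p => ?_
        exact mul_ne_zero (by exact_mod_cast (by omega : m ≠ 0))
          (pow_ne_zero _ (neg_ne_zero.2 (mul_ne_zero hε
            (pow_ne_zero _ (ne_zero_of_one_mul_sq_pos p.1.2)))))
      · fun_prop
      · fun_prop
    · split_ifs <;> fun_prop

end ArcSpaces

/-! ### Coefficients of the zeta functions and the comparison -/

section ZetaCoefficients

variable {m k n : ℕ} {ε : ℤˣ} {σ : ℝ}

theorem coeff_zetaPos (hn : n ≠ 0) :
    PowerSeries.coeff n (zetaPos (starSum (signedPower 1 m) (signedPower ε k))) =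
      eulerCharCompact (signedArcs n m k ε 1) := by
  rw [zetaPos, PowerSeries.coeff_mk, if_neg hn, arcsPos_eq]
  simp

theorem coeff_zetaNeg (hn : n ≠ 0) :
    PowerSeries.coeff n (zetaNeg (starSum (signedPower 1 m) (signedPower ε k))) =
      eulerCharCompact (signedArcs n m k ε (-1)) := by
  rw [zetaNeg, PowerSeries.coeff_mk, if_neg hn, arcsNeg_eq]
  simp

theorem eulerCharCompact_signedArcs_of_lt (hm : 0 < m) (hnk : n < k) (hmn : ¬ m ∣ n) :
    (eulerCharCompact (signedArcs n m k ε σ)).natAbs = 0 := by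
  have : IsEmpty (signedArcs n m k ε σ) := by
    rw [signedArcs_eq_empty hm hnk hmn]
    infer_instance
  rw [eulerCharCompact_of_isEmpty, Int.natAbs_zero]

theorem eulerCharCompact_signedArcs_self (hm : 0 < m) (hk : 0 < k) (hmk : ¬ m ∣ k) :
    (eulerCharCompact (signedArcs k m k ε σ)).natAbs = (signSet (σ * ε) k).ncard :=
  natAbs_eulerCharCompact_eq hk.ne' (signedArcsSelfHomeomorph hm hk hmk)

theorem eulerCharCompact_signedArcs_succ (hm : 1 < m) (hodd : Odd m) (hk : 0 < k) (hmk : m ∣ k)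
    (hσ : σ = 1 ∨ σ = -1) :
    (eulerCharCompact (signedArcs (k + 1) m k ε σ)).natAbs = 2 := by
  obtain ⟨q, hq⟩ := hmk
  have hq0 : 0 < q := Nat.pos_of_ne_zero fun h => by simp [h] at hq; omega
  have hqk : q ≤ k := hq ▸ Nat.le_mul_of_pos_left q (by omega)
  rw [natAbs_eulerCharCompact_eq two_ne_zero
    (signedArcsSuccHomeomorph hm hodd hq0 hq (by omega) hqk hσ), signSet_even_one even_two]

end ZetaCoefficients

/-- The zeta functions of `xᵐ + ε yᵏ` and `xᵐ + ε' yᵏ'` differ if `k < k'`. -/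
theorem not_lt_of_zeta_eq {m : ℕ} (hm : 1 < m) (hodd : Odd m)
    {k k' : ℕ} (hk : 1 ≤ k) {ε ε' : ℤˣ}
    (hpos : zetaPos (starSum (signedPower 1 m) (signedPower ε k)) =
      zetaPos (starSum (signedPower 1 m) (signedPower ε' k')))
    (hneg : zetaNeg (starSum (signedPower 1 m) (signedPower ε k)) =
      zetaNeg (starSum (signedPower 1 m) (signedPower ε' k'))) : ¬ k < k' := by
  intro hlt
  have key : ∀ n, n ≠ 0 →
      eulerCharCompact (signedArcs n m k ε 1) = eulerCharCompact (signedArcs n m k' ε' 1) ∧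
      eulerCharCompact (signedArcs n m k ε (-1)) = eulerCharCompact (signedArcs n m k' ε' (-1)) :=
    fun n hn => ⟨by rw [← coeff_zetaPos hn, hpos, coeff_zetaPos hn],
      by rw [← coeff_zetaNeg hn, hneg, coeff_zetaNeg hn]⟩
  -- If m ∣ k, order k + 1 is decisive: each sign gives 2 for k, while for k' both give 0 (k + 1 <
  -- k') or the two add up to 2 (k + 1 = k'). If m ∤ k, order k is decisive: the signs add up to 2
  -- for k and both give 0 for k'.
  by_cases hmk : m ∣ k
  · obtain ⟨h1, h2⟩ := key (k + 1) (by omega)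
    have hmk1 : ¬ m ∣ k + 1 := fun h => by
      have := Nat.le_of_dvd one_pos ((Nat.dvd_add_right hmk).1 h)
      omega
    have e1 := eulerCharCompact_signedArcs_succ (ε := ε) hm hodd hk hmk (Or.inl rfl)
    have e2 := eulerCharCompact_signedArcs_succ (ε := ε) hm hodd hk hmk (Or.inr rfl)
    rw [h1] at e1
    rw [h2] at e2
    rcases Nat.lt_or_eq_of_le (Nat.succ_le_of_lt hlt) with h | h
    · rw [eulerCharCompact_signedArcs_of_lt (by omega) h hmk1] at e1
      omega
    · subst h
      rw [eulerCharCompact_signedArcs_self (by omega) (by omega) hmk1, one_mul] at e1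
      rw [eulerCharCompact_signedArcs_self (by omega) (by omega) hmk1, neg_one_mul] at e2
      have := signSet_add_signSet_neg (k := k + 1) (units_cast_eq ε')
      omega
  · obtain ⟨h1, h2⟩ := key k (by omega)
    have e1 := eulerCharCompact_signedArcs_self (ε := ε) (σ := 1) (by omega : 0 < m) hk hmk
    have e2 := eulerCharCompact_signedArcs_self (ε := ε) (σ := -1) (by omega : 0 < m) hk hmk
    rw [h1, eulerCharCompact_signedArcs_of_lt (by omega) hlt hmk, one_mul] at e1
    rw [h2, eulerCharCompact_signedArcs_of_lt (by omega) hlt hmk, neg_one_mul] at e2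
    have := signSet_add_signSet_neg (k := k) (units_cast_eq ε)
    omega

theorem mainTheorem10 (m : ℕ) (hm : 1 < m) (hodd : Odd m)
    (k k' : ℕ) (hk : 1 ≤ k) (hk' : 1 ≤ k') (ε ε' : ℤˣ)
    (hpos : zetaPos (starSum (signedPower 1 m) (signedPower ε k)) =
      zetaPos (starSum (signedPower 1 m) (signedPower ε' k')))
    (hneg : zetaNeg (starSum (signedPower 1 m) (signedPower ε k)) =
      zetaNeg (starSum (signedPower 1 m) (signedPower ε' k'))) :
    k = k' ∧ (Even k → ¬ m ∣ k → ε = ε') := by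
  have hkk : k = k' := le_antisymm
    (not_lt.1 (not_lt_of_zeta_eq hm hodd hk' hpos.symm hneg.symm))
    (not_lt.1 (not_lt_of_zeta_eq hm hodd hk hpos hneg))
  refine ⟨hkk, fun heven hmk => ?_⟩
  subst hkk
  -- For k even the positive coefficient at k has absolute value 2 if ε = 1 and 0 if ε = -1, so it
  -- alone recovers ε.
  have h : eulerCharCompact (signedArcs k m k ε 1) = eulerCharCompact (signedArcs k m k ε' 1) := by
    rw [← coeff_zetaPos (by omega), hpos, coeff_zetaPos (by omega)]
  have h' := congrArg Int.natAbs h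
  rw [eulerCharCompact_signedArcs_self (by omega) hk hmk,
    eulerCharCompact_signedArcs_self (by omega) hk hmk, one_mul, one_mul] at h'
  rcases Int.units_eq_one_or ε with rfl | rfl <;> rcases Int.units_eq_one_or ε' with rfl | rfl <;>
    simp [signSet_even_one heven, signSet_even_neg_one heven] at h' ⊢
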